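/- Let $\lambda$ be a partition with largest part $L=\lambda_1$ and conjugate $\lambda'$, and let $n\ge 0$ be an integer. Consider arrangements of balls on an $L\times n$ array, at most one ball per site, with rows numbered $1,\dots,L$ from bottom to top and columns $1,\dots,n$ from left to right. A \emph{multiline queue} of shape $(\lambda,n)$ is such an arrangement with exactly $\lambda'_r$ balls in row $r$ for every $r$; let $\mathrm{MLQ}_\lambda$ be the set of these. \emph{Type.} Label the balls of an arrangement as follows. For $r=L,L-1,\dots,2$: every unlabeled ball of row $r$ gets the label $r$; then the balls of row $r$, taken from the largest label to the smallest and from left to right among equal labels, are one after the other paired to the first unlabeled ball weakly to their right in row $r-1$ (wrapping around from column $n$ to column $1$ if necessary), which acquires the same label. Finally the unlabeled balls of row $1$ get the label $1$. The \emph{type} is the sequence of the labels in row $1$, read from left to right, with $0$ for an empty site; the \emph{strong type} $\mathrm{strtype}$ is the type with the zeros deleted. \emph{Bracketing.} In a word $w$ of positive integers, replace each letter $i+1$ by ``('' and each letter $i$ by ``)'', ignore the other letters, and match parentheses in the usual way; the remaining letters $i$, $i+1$ are called unmatched. The \emph{row word} of $M$ records the columns of the balls, reading the rows from top to bottom and each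 row from right to left; the \emph{column word} records the rows of the balls, reading the columns from left to right and each column from top to bottom. \emph{Crystal graph.} For $1\le i\le n-1$, the operator $f_i^{\rightarrow}$ moves the ball of the rightmost unmatched $i$ in the row word of $M$ from column $i$ to column $i+1$ (and fixes $M$ if there is none). The crystal graph on $\mathrm{MLQ}_\lambda$ has an edge $M\to f_i^{\rightarrow}M$ for all $M$ and $i$; its connected components are those of the underlying undirected graph. \emph{Collapsing.} For $1\le i\le L-1$, the operator $e_i^{\downarrow}$ moves the ball of the leftmost unmatched $i+1$ in the column word of $M$ from row $i+1$ to row $i$ (and fixes $M$ if there is none), and $e_i^{\downarrow\star}$ applies $e_i^{\downarrow}$ until it acts trivially. Put $e^{\downarrow\star}_{[k,1]}=e_1^{\downarrow\star}e_2^{\downarrow\star}\cdots e_k^{\downarrow\star}$ (rightmost factor first) and $$\rho = e^{\downarrow\star}_{[L-1,1]}\cdots e^{\downarrow\star}_{[2,1]}\,e^{\downarrow\star}_{[1,1]}.$$ \textbf{Proposition.} Let $M,M'\in\mathrm{MLQ}_\lambda$ lie in the same connected component of the crystal graph. Then $$\mathrm{strtype}(\rho(M))=\mathrm{strtype}(\rho(M'))\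 \Longrightarrow\ \mathrm{strtype}(M)=\mathrm{strtype}(M').$$ -/

import Mathlib

/-!
Multiline queues, the Ferrari-Martin labelling, crystal operators and the collapsing map.
Rows are numbered `1, …, L` from bottom to top, columns `1, …, n` from left to right, and a site
is a pair `(row, column)`.
-/

namespace MultilineQueue

/-- A ball arrangement: the finite set of occupied sites `(row, column)`. A generalized multiline
queue of size `L × n` is an arrangement inside the grid `{1,…,L} × {1,…,n}`. -/
abbrev Arr := Finset (ℕ × ℕ)

/-- The set `B_r` of columns of the balls in row `r`. -/
def rowSet (M : Arr) (r : ℕ) : Finset ℕ := (M.filter fun b => b.1 = r).image Prod.snd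

/-- A partition `lam` is given by its Young diagram: `lam.rowLen i` is the part `λ_{i+1}` and
`lam.colLen j` is the part `λ'_{j+1}` of the conjugate partition. The number of rows of a multiline
queue of shape `lam` is the largest part `λ₁`. -/
def numRows (lam : YoungDiagram) : ℕ := lam.rowLen 0

/-- Multiline queues of shape `(lam, n)`: arrangements in the `λ₁ × n` grid with `λ'_r` balls in
row `r`, for each `r`. -/
structure MLQ (lam : YoungDiagram) (n : ℕ) where
  balls : Arr
  subset_grid : balls ⊆ Finset.Icc 1 (numRows lam) ×ˢ Finset.Icc 1 n
  card_row : ∀ r ∈ Finset.Icc 1 (numRows lam), (rowSet balls r).card = lam.colLen (r - 1)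

/-! ### Ferrari-Martin algorithm -/

/-- The columns `c, c+1, …, n, 1, …, c-1`, in the order in which a ball in column `c` meets them. -/
def cyclicFrom (n c : ℕ) : List ℕ := List.range' c (n + 1 - c) ++ List.range' 1 (c - 1)

/-- The balls (columns) of a fully labelled row in the order in which they are paired: from the
largest label `L` to the smallest, and from left to right among equal labels. The label `0` means
an empty site. -/
def pairingOrder (L n : ℕ) (lab : ℕ → ℕ) : List ℕ :=
  (List.range' 1 L).reverse.flatMap fun k => (List.range' 1 n).filter fun c => lab c = k

/-- One pairing: a ball in column `c` with label `k` is paired to the first unlabelled ball weakly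
to its right (cyclically) in the row `B` below, which acquires the label `k`. `low` is the current
labelling of the row `B`, with `0` for a site that has no label. -/
def pairBall (n : ℕ) (B : Finset ℕ) (k : ℕ) (low : ℕ → ℕ) (c : ℕ) : ℕ → ℕ :=
  match (cyclicFrom n c).find? (fun x => decide (x ∈ B ∧ low x = 0)) with
  | none => low
  | some x => Function.update low x k

/-- The labels of row `r` with set of balls `B`, from the labels `up` of row `r + 1`: pair all balls
of row `r + 1`, then give the label `r` to every ball that is still unlabelled. -/
def labelStep (L n r : ℕ) (B : Finset ℕ) (up : ℕ → ℕ) : ℕ → ℕ :=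
  let low := (pairingOrder L n up).foldl (fun low c => pairBall n B (up c) low c) (fun _ => 0)
  fun c => if c ∈ B ∧ low c = 0 then r else low c

/-- `fmRow L n M d` is the labelling of row `L + 1 - d`, computed from the top row downwards
(row `L + 1` is empty). -/
def fmRow (L n : ℕ) (M : Arr) : ℕ → ℕ → ℕ
  | 0 => fun _ => 0
  | d + 1 => labelStep L n (L - d) (rowSet M (L - d)) (fmRow L n M d)

/-- The labelled array `L_M(r, c)` produced by the Ferrari-Martin algorithm. -/
def label (L n : ℕ) (M : Arr) (r c : ℕ) : ℕ := fmRow L n M (L + 1 - r) c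

/-- The type of `M`: the labels of the bottom row, with `0` for an empty site. -/
def type (L n : ℕ) (M : Arr) : List ℕ := (List.range' 1 n).map (label L n M 1)

/-- The strong type of `M`: its type with the zeros deleted. -/
def strtype (L n : ℕ) (M : Arr) : List ℕ := (type L n M).filter fun a => a ≠ 0

/-! ### Reading words, bracketing and crystal operators -/

/-- The balls of `M` in the order of the row word: rows from top to bottom, each row from right to
left. The row word is the list of the columns of these balls. -/
def rowReading (L n : ℕ) (M : Arr) : List (ℕ × ℕ) :=
  ((List.range' 1 L).reverse.flatMap fun r => (List.range' 1 n).reverse.map fun c => (r, c)).filter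
    fun b => b ∈ M

/-- The balls of `M` in the order of the column word: columns from left to right, each column from
top to bottom. The column word is the list of the rows of these balls. -/
def colReading (L n : ℕ) (M : Arr) : List (ℕ × ℕ) :=
  ((List.range' 1 n).flatMap fun c => (List.range' 1 L).reverse.map fun r => (r, c)).filter
    fun b => b ∈ M

/-- One step of the bracketing rule, scanning a word from left to right, where `b` carries the
letter `letter b`. A letter `i + 1` is an opening and a letter `i` a closing parenthesis. The state
consists of the unmatched closing and the currently open parentheses, most recent first. -/
def bracketStep (letter : ℕ × ℕ → ℕ) (i : ℕ) (s : List (ℕ × ℕ) × List (ℕ × ℕ)) (b : ℕ × ℕ) :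
    List (ℕ × ℕ) × List (ℕ × ℕ) :=
  if letter b = i + 1 then (s.1, b :: s.2)
  else if letter b = i then
    match s.2 with
    | [] => (b :: s.1, [])
    | _ :: t => (s.1, t)
  else s

/-- The balls carrying unmatched letters `i` (first component) and unmatched letters `i + 1`
(second component), both listed from right to left. -/
def unmatched (letter : ℕ × ℕ → ℕ) (i : ℕ) (w : List (ℕ × ℕ)) : List (ℕ × ℕ) × List (ℕ × ℕ) :=
  w.foldl (bracketStep letter i) ([], [])

/-- Move the ball at site `b` to site `b'`. -/
def moveBall (M : Arr) (b b' : ℕ × ℕ) : Arr := insert b' (M.erase b)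

/-- Column operator `f_i^→`: the ball of the rightmost unmatched `i` in the row word moves from
column `i` to column `i + 1`. -/
def fRight (L n i : ℕ) (M : Arr) : Arr :=
  match (unmatched Prod.snd i (rowReading L n M)).1.head? with
  | none => M
  | some b => moveBall M b (b.1, i + 1)

/-- Row dropping operator `e_i^↓`: the ball of the leftmost unmatched `i + 1` in the column word
moves from row `i + 1` to row `i`. -/
def eDown (L n i : ℕ) (M : Arr) : Arr :=
  match (unmatched Prod.fst i (colReading L n M)).2.getLast? with
  | none => M
  | some b => moveBall M b (i, b.2)

/-- The operator `e_i^{↓⋆}`: apply `e_i^↓` until it acts trivially. As each nontrivial application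
removes a ball from row `i + 1`, the iterates are constant from the `|M|`-th on. -/
def eDownStar (L n i : ℕ) (M : Arr) : Arr := (eDown L n i)^[M.card] M

/-! ### The crystal graph -/

/-- The crystal graph on the multiline queues of shape `(lam, n)`: a directed edge from `M` to `M'`
whenever `M' = f_i^→ M` for some column index `1 ≤ i ≤ n - 1`. -/
def crystalGraph (lam : YoungDiagram) (n : ℕ) : Digraph (MLQ lam n) where
  Adj M M' := ∃ i, 1 ≤ i ∧ i + 1 ≤ n ∧ M'.balls = fRight (numRows lam) n i M.balls

/-- `M` and `M'` lie in the same connected component of the crystal graph, whose edges may be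
traversed in both directions. -/
def SameComponent {lam : YoungDiagram} {n : ℕ} (M M' : MLQ lam n) : Prop :=
  (crystalGraph lam n).toSimpleGraphInclusive.Reachable M M'

/-! ### The collapsing map -/

/-- `e^{↓⋆}_{[k,1]} = e_1^{↓⋆} ⋯ e_{k-1}^{↓⋆} e_k^{↓⋆}`, with `e_k^{↓⋆}` applied first. -/
def dropFrom (L n : ℕ) : ℕ → Arr → Arr
  | 0, M => M
  | k + 1, M => dropFrom L n k (eDownStar L n (k + 1) M)

/-- `e^{↓⋆}_{[k,1]} ⋯ e^{↓⋆}_{[2,1]} e^{↓⋆}_{[1,1]}`, with `e^{↓⋆}_{[1,1]}` applied first. -/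
def collapseUpTo (L n : ℕ) : ℕ → Arr → Arr
  | 0, M => M
  | k + 1, M => dropFrom L n (k + 1) (collapseUpTo L n k M)

/-- The collapsing map `ρ = ρ_N`. Its value is kept in the same `L × n` grid; the rows that it
leaves empty at the top have no effect on the labelling. -/
def rho (L n : ℕ) (M : Arr) : Arr := collapseUpTo L n (L - 1) M

end MultilineQueue

/-! Fix k. The bottom balls with label greater than k arise by matching row k + 1 cyclically through
the rows k, …, 1. Greedy cyclic pairing matches the same set of lower balls in whatever order the
upper balls are taken (`isFree_insert`), so every threshold set of labels propagates on its own
(`geSet_label_one`). Discarding the unmatched balls of a row amounts to lifting them by inverse row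
droppings, and the number of lifts depends only on the shape. Hence the threshold set is the bottom
row of an arrangement P obtained from M by inverse row droppings of prescribed lengths
(`exists_upSeq_push`).

Now bring P to highest weight: first collapse the rows from 2 on among themselves, which leaves the
bottom row alone, then perform one ascending sweep of maximal droppings at 1, 2, …, L - 1. The
result is ρ(M), and the lengths of the dropping strings depend only on the component of M. Indeed
row and column operators commute (`DownAt.diamond`), so the lengths are constant along edges, and
the result need only be identified at a source of the crystal graph. There both candidates are
highest weight in both directions, and such an arrangement is determined by its column contents
(`eq_of_highest`, `exists_hasExponents`).

Finally undo the ascending sweep. Undoing one string deletes from the lower row its rightmost balls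
that are unmatched with the row above (`DownN.rowSet_lower`). In a highest weight arrangement the
pairing never wraps, and pushing sets to the bottom row then commutes with these deletions
(`matched_delTop`). The bottom row of P is therefore computed by `trim` from the sets of bottom
balls of ρ(M) with label at least m (`push_rowTrim`). This recipe uses only the left-to-right order
and the exponents, so the strong type of ρ(M) and the component determine which bottom positions of
ρ(M) carry a label greater than k in M (`le_label_iff`). Letting k vary recovers the strong type of
M. -/

namespace MultilineQueue

/-! ### Bracketing in terms of heights -/

/-- The effect on the bracketing state of a pair of sites, `b'` carrying the opening and `b` the
closing parenthesis, read in this order. -/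
def pairStep (M : Arr) (b' b : ℕ × ℕ) (s : List (ℕ × ℕ) × List (ℕ × ℕ)) :
    List (ℕ × ℕ) × List (ℕ × ℕ) :=
  if b' ∈ M then (if b ∈ M then s else (s.1, b' :: s.2))
  else if b ∈ M then
    match s.2 with
    | [] => (b :: s.1, [])
    | _ :: t => (s.1, t)
  else s

theorem foldl_bracketStep_of_forall_ne (letter : ℕ × ℕ → ℕ) (i : ℕ) (l : List (ℕ × ℕ))
    (h : ∀ b ∈ l, letter b ≠ i + 1 ∧ letter b ≠ i) (s : List (ℕ × ℕ) × List (ℕ × ℕ)) :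
    l.foldl (bracketStep letter i) s = s := by
  induction l generalizing s with
  | nil => rfl
  | cons b l ih =>
    have hb := h b (by simp)
    rw [List.foldl_cons, ih (fun b hb => h b (by simp [hb]))]
    simp [bracketStep, hb.1, hb.2]

theorem foldl_bracketStep_block (letter : ℕ × ℕ → ℕ) (i K : ℕ) (hi : 1 ≤ i) (hK : i + 1 ≤ K)
    (mk : ℕ → ℕ × ℕ) (hmk : ∀ k, letter (mk k) = k) (M : Arr)
    (s : List (ℕ × ℕ) × List (ℕ × ℕ)) :
    (((List.range' 1 K).reverse.map mk).filter fun b => b ∈ M).foldl (bracketStep letter i) s =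
      pairStep M (mk (i + 1)) (mk i) s := by
  have h : List.range' 1 K =
      List.range' 1 (i - 1) ++ ([i, i + 1] ++ List.range' (i + 2) (K - i - 1)) := by
    have h1 : K = (i - 1) + (2 + (K - i - 1)) := by omega
    have h2 : [i, i + 1] = List.range' i 2 := rfl
    rw [h2]
    conv_lhs => rw [h1]
    rw [List.range'_append_1, ← List.range'_append_1]
    congr 2
    omega
  rw [h, List.reverse_append, List.reverse_append, List.map_append, List.map_append,
    List.filter_append, List.filter_append, List.foldl_append, List.foldl_append]
  rw [foldl_bracketStep_of_forall_ne letter i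
      (List.filter _ (List.map mk (List.range' 1 (i - 1)).reverse)) _,
    foldl_bracketStep_of_forall_ne letter i
      (List.filter _ (List.map mk (List.range' (i + 2) (K - i - 1)).reverse)) _]
  · rcases s with ⟨C, _ | ⟨x, O⟩⟩ <;> by_cases h1 : mk (i + 1) ∈ M <;> by_cases h2 : mk i ∈ M <;>
      simp [pairStep, bracketStep, h1, h2, hmk]
  · intro b hb
    simp only [List.mem_filter, List.mem_map, List.mem_reverse, List.mem_range'_1] at hb
    obtain ⟨⟨k, hk, rfl⟩, -⟩ := hb
    rw [hmk]; omega
  · intro b hb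
    simp only [List.mem_filter, List.mem_map, List.mem_reverse, List.mem_range'_1] at hb
    obtain ⟨⟨k, hk, rfl⟩, -⟩ := hb
    rw [hmk]; omega

theorem foldl_bracketStep_flatMap (letter : ℕ × ℕ → ℕ) (i K : ℕ) (hi : 1 ≤ i) (hK : i + 1 ≤ K)
    (mk : ℕ → ℕ → ℕ × ℕ) (hmk : ∀ p k, letter (mk p k) = k) (M : Arr) (ps : List ℕ)
    (s : List (ℕ × ℕ) × List (ℕ × ℕ)) :
    ((ps.flatMap fun p => (List.range' 1 K).reverse.map (mk p)).filter fun b => b ∈ M).foldl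
      (bracketStep letter i) s =
    ps.foldl (fun s p => pairStep M (mk p (i + 1)) (mk p i) s) s := by
  rw [List.filter_flatMap, List.foldl_flatMap]
  congr 1
  funext s p
  exact foldl_bracketStep_block letter i K hi hK (mk p) (hmk p) M s

section Fold

variable {M : Arr} {op cl : ℕ → ℕ × ℕ} {h : ℕ → ℤ}

/-- The height `h` records the excess of opening over closing parentheses from a position on. -/
def IsHeight (M : Arr) (op cl : ℕ → ℕ × ℕ) (h : ℕ → ℤ) (n : ℕ) : Prop :=
  ∀ p, 1 ≤ p → p ≤ n →
    h p = h (p + 1) + (if op p ∈ M then 1 else 0) - (if cl p ∈ M then 1 else 0)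

theorem pairStep_snd_length (b' b : ℕ × ℕ) (s : List (ℕ × ℕ) × List (ℕ × ℕ)) :
    ((pairStep M b' b s).2.length : ℤ) =
      max 0 ((s.2.length : ℤ) + (if b' ∈ M then 1 else 0) - (if b ∈ M then 1 else 0)) := by
  obtain ⟨C, O⟩ := s
  cases O <;> by_cases h1 : b' ∈ M <;> by_cases h2 : b ∈ M <;> simp [pairStep, h1, h2] <;> omega

/-- By the `max 0` recursion, the final stack size is the maximum of |s.2| + h a and the later
heights, minus the final height. It vanishes as soon as the final height dominates. -/
theorem foldl_pairStep_snd_eq_nil {n : ℕ} (hh : IsHeight M op cl h n) (a k : ℕ) (ha : 1 ≤ a)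
    (hk : a + k ≤ n + 1) (hmax : ∀ p, a < p → p < a + k → h p ≤ h (a + k))
    (s : List (ℕ × ℕ) × List (ℕ × ℕ)) (hs : (s.2.length : ℤ) + h a ≤ h (a + k)) :
    ((List.range' a k).foldl (fun s p => pairStep M (op p) (cl p) s) s).2 = [] := by
  induction k generalizing a s with
  | zero =>
    simp only [List.range'_zero, List.foldl_nil]
    simp only [Nat.add_zero] at hs
    exact List.length_eq_zero_iff.1 (by omega)
  | succ k ih =>
    rw [List.range'_succ, List.foldl_cons]
    have e : a + 1 + k = a + (k + 1) := by omega
    apply ih (a + 1) (by omega) (by omega)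
    · intro p h1 h2
      rw [e]; exact hmax p (by omega) (by omega)
    · rw [pairStep_snd_length, e]
      have h1 := hh a ha (by omega)
      have h2 : h (a + 1) ≤ h (a + (k + 1)) := by
        rcases Nat.eq_zero_or_pos k with rfl | hk0
        · simp
        · exact hmax _ (by omega) (by omega)
      rcases max_cases (0 : ℤ) ((s.2.length : ℤ) + (if op a ∈ M then 1 else 0) -
        (if cl a ∈ M then 1 else 0)) with h3 | h3 <;> omega

/-- The part of the stack above R has exactly |O| + h a - h p entries when position p is reached.
The height bound keeps this nonnegative, so no closing parenthesis reaches R or stays unmatched. -/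
theorem foldl_pairStep_of_min {n : ℕ} (hh : IsHeight M op cl h n) (a k : ℕ) (ha : 1 ≤ a)
    (hk : a + k ≤ n + 1) (C O R : List (ℕ × ℕ))
    (hmin : ∀ p, a < p → p ≤ a + k → h p ≤ h a + O.length) :
    ∃ O', (List.range' a k).foldl (fun s p => pairStep M (op p) (cl p) s) (C, O ++ R) =
      (C, O' ++ R) := by
  induction k generalizing a O with
  | zero => exact ⟨O, rfl⟩
  | succ k ih =>
    rw [List.range'_succ, List.foldl_cons]
    have h1 := hh a ha (by omega)
    have h0 := hmin (a + 1) (by omega) (by omega)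
    by_cases h2 : op a ∈ M <;> by_cases h3 : cl a ∈ M <;>
      simp only [h2, h3, if_true, if_false] at h1
    · have e : pairStep M (op a) (cl a) (C, O ++ R) = (C, O ++ R) := by simp [pairStep, h2, h3]
      rw [e]
      refine ih (a + 1) (by omega) (by omega) O fun p hp hp' => ?_
      have := hmin p (by omega) (by omega); omega
    · have e : pairStep M (op a) (cl a) (C, O ++ R) = (C, (op a :: O) ++ R) := by
        simp [pairStep, h2, h3]
      rw [e]
      refine ih (a + 1) (by omega) (by omega) _ fun p hp hp' => ?_
      have := hmin p (by omega) (by omega)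
      simp only [List.length_cons]; push_cast; omega
    · cases O with
      | nil => simp at h0; omega
      | cons x O =>
        have e : pairStep M (op a) (cl a) (C, x :: O ++ R) = (C, O ++ R) := by
          simp [pairStep, h2, h3]
        rw [e]
        refine ih (a + 1) (by omega) (by omega) _ fun p hp hp' => ?_
        have := hmin p (by omega) (by omega)
        simp only [List.length_cons] at this; push_cast at this; omega
    · have e : pairStep M (op a) (cl a) (C, O ++ R) = (C, O ++ R) := by simp [pairStep, h2, h3]
      rw [e]
      refine ih (a + 1) (by omega) (by omega) O fun p hp hp' => ?_
      have := hmin p (by omega) (by omega); omega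

theorem range'_split (n c : ℕ) (hc : 1 ≤ c) (hcn : c ≤ n) :
    List.range' 1 n = List.range' 1 (c - 1) ++ c :: List.range' (c + 1) (n - c) := by
  rw [← List.range'_succ, show n = (c - 1) + (n - c + 1) by omega, ← List.range'_append_1]
  congr 2 <;> omega

/-- The leftmost unmatched opening sits at the last maximum of the height: the stack is empty on
arrival, and afterwards the height stays lower, so nothing closes it. The stack lists the most
recent entry first, hence `getLast?`. -/
theorem foldl_pairStep_open {n c : ℕ} (hh : IsHeight M op cl h n) (hc : 1 ≤ c) (hcn : c ≤ n)
    (h1 : ∀ p, 1 ≤ p → p ≤ c → h p ≤ h c) (h2 : ∀ p, c < p → p ≤ n + 1 → h p < h c) :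
    ((List.range' 1 n).foldl (fun s p => pairStep M (op p) (cl p) s) ([], [])).2.getLast? =
      some (op c) := by
  rw [range'_split n c hc hcn, List.foldl_append, List.foldl_cons]
  have e : 1 + (c - 1) = c := by omega
  have hu := foldl_pairStep_snd_eq_nil hh 1 (c - 1) le_rfl (by omega)
    (by rw [e]; intro p hp hp'; exact h1 p (by omega) (by omega)) ([], [])
    (by rw [e]; simpa using h1 1 le_rfl hc)
  generalize (List.range' 1 (c - 1)).foldl (fun s p => pairStep M (op p) (cl p) s) ([], []) = s
    at hu ⊢
  obtain ⟨C, O⟩ := s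
  simp only at hu
  subst hu
  have h3 := hh c hc hcn
  have h4 := h2 (c + 1) (by omega) (by omega)
  have hop : op c ∈ M := by
    by_contra hop; simp only [hop, if_false] at h3; split_ifs at h3 <;> omega
  have hcl : cl c ∉ M := by
    intro hcl; simp only [hop, hcl, if_true] at h3; omega
  have e2 : pairStep M (op c) (cl c) (C, []) = (C, [] ++ [op c]) := by simp [pairStep, hop, hcl]
  simp only [hop, hcl, if_true, if_false] at h3
  rw [e2]
  obtain ⟨O', hO'⟩ := foldl_pairStep_of_min hh (c + 1) (n - c) (by omega) (by omega) C [] [op c]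
    (fun p hp hp' => by have := h2 p (by omega) (by omega); simp; omega)
  rw [hO']
  simp

theorem foldl_pairStep_open_null {n : ℕ} (hh : IsHeight M op cl h n)
    (h1 : ∀ p, 1 ≤ p → p ≤ n → h p ≤ h (n + 1)) :
    ((List.range' 1 n).foldl (fun s p => pairStep M (op p) (cl p) s) ([], [])).2 = [] := by
  have e : 1 + n = n + 1 := by omega
  refine foldl_pairStep_snd_eq_nil hh 1 n le_rfl (by omega) ?_ ([], []) ?_
  · rw [e]; intro p hp hp'; exact h1 p (by omega) (by omega)
  · rw [e]
    rcases Nat.eq_zero_or_pos n with rfl | hn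
    · simp
    · simpa using h1 1 le_rfl hn

/-- Dually, the rightmost unmatched closing sits one position before the first maximum of the
height. -/
theorem foldl_pairStep_close {n c : ℕ} (hh : IsHeight M op cl h n) (hc : 1 ≤ c) (hcn : c ≤ n)
    (h1 : ∀ p, 1 ≤ p → p ≤ c → h p < h (c + 1)) (h2 : ∀ p, c < p → p ≤ n + 1 → h p ≤ h (c + 1)) :
    ((List.range' 1 n).foldl (fun s p => pairStep M (op p) (cl p) s) ([], [])).1.head? =
      some (cl c) := by
  rw [range'_split n c hc hcn, List.foldl_append, List.foldl_cons]
  have e : 1 + (c - 1) = c := by omega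
  have h3 := hh c hc hcn
  have h4 := h1 c hc le_rfl
  have hop : op c ∉ M := by
    intro hop; simp only [hop, if_true] at h3; split_ifs at h3 <;> omega
  have hcl : cl c ∈ M := by
    by_contra hcl; simp only [hop, hcl, if_false] at h3; omega
  simp only [hop, hcl, if_true, if_false] at h3
  have hu := foldl_pairStep_snd_eq_nil hh 1 (c - 1) le_rfl (by omega)
    (by rw [e]; intro p hp hp'; have := h1 p (by omega) (by omega); omega) ([], [])
    (by rw [e]; have := h1 1 le_rfl hc; simp; omega)
  generalize (List.range' 1 (c - 1)).foldl (fun s p => pairStep M (op p) (cl p) s) ([], []) = s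
    at hu ⊢
  obtain ⟨C, O⟩ := s
  simp only at hu
  subst hu
  have e2 : pairStep M (op c) (cl c) (C, []) = (cl c :: C, [] ++ []) := by
    simp [pairStep, hop, hcl]
  rw [e2]
  obtain ⟨O', hO'⟩ := foldl_pairStep_of_min hh (c + 1) (n - c) (by omega) (by omega) (cl c :: C)
    [] [] (fun p hp hp' => by have := h2 p (by omega) (by omega); simp; omega)
  rw [hO']
  simp

theorem foldl_pairStep_close_null {n : ℕ} (hh : IsHeight M op cl h n)
    (h1 : ∀ p, 1 ≤ p → p ≤ n + 1 → h p ≤ h 1) :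
    ((List.range' 1 n).foldl (fun s p => pairStep M (op p) (cl p) s) ([], [])).1 = [] := by
  obtain ⟨O', hO'⟩ := foldl_pairStep_of_min hh 1 n le_rfl (by omega) [] [] []
    (fun p hp hp' => by have := h1 p (by omega) (by omega); simpa using this)
  simp only [List.append_nil] at hO'
  rw [hO']

end Fold

theorem unmatched_colReading (L n j : ℕ) (hj : 1 ≤ j) (hjL : j + 1 ≤ L) (M : Arr) :
    unmatched Prod.fst j (colReading L n M) =
      (List.range' 1 n).foldl (fun s p => pairStep M (j + 1, p) (j, p) s) ([], []) :=
  foldl_bracketStep_flatMap Prod.fst j L hj hjL (fun c r => (r, c)) (fun _ _ => rfl) M _ _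

theorem reverse_range'_eq_map (L : ℕ) :
    (List.range' 1 L).reverse = (List.range' 1 L).map fun p => L + 1 - p := by
  rw [List.reverse_range', List.range'_eq_map_range, List.map_map]
  apply List.map_congr_left
  intro a ha
  simp
  omega

theorem unmatched_rowReading (L n i : ℕ) (hi : 1 ≤ i) (hin : i + 1 ≤ n) (M : Arr) :
    unmatched Prod.snd i (rowReading L n M) =
      (List.range' 1 L).foldl
        (fun s p => pairStep M (L + 1 - p, i + 1) (L + 1 - p, i) s) ([], []) := by
  have := foldl_bracketStep_flatMap Prod.snd i n hi hin (fun r c => (r, c)) (fun _ _ => rfl) M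
    (List.range' 1 L).reverse ([], [])
  rw [unmatched, rowReading, this, reverse_range'_eq_map, List.foldl_map]

/-! ### Heights of row and column pairs -/

/-- The indicator of a site being occupied. -/
def ind (M : Arr) (r c : ℕ) : ℤ := if (r, c) ∈ M then 1 else 0

/-- The number of balls of row `r` in the columns from `t` on. -/
def rowTail (M : Arr) (r t : ℕ) : ℤ := ((M.filter fun b => b.1 = r ∧ t ≤ b.2).card : ℤ)

/-- The number of balls of column `c` in the rows up to `s`. -/
def colHead (M : Arr) (c s : ℕ) : ℤ := ((M.filter fun b => b.2 = c ∧ b.1 ≤ s).card : ℤ)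

/-- The excess of row `j + 1` over row `j` in the columns from `t` on. -/
def rowHt (M : Arr) (j t : ℕ) : ℤ := rowTail M (j + 1) t - rowTail M j t

/-- The excess of column `i + 1` over column `i` in the rows up to `s`. -/
def colHt (M : Arr) (i s : ℕ) : ℤ := colHead M (i + 1) s - colHead M i s

/-- `M` is an arrangement in the `L × n` grid. -/
def InGrid (L n : ℕ) (M : Arr) : Prop := M ⊆ Finset.Icc 1 L ×ˢ Finset.Icc 1 n

/-- `M'` arises from `M` by a nontrivial row dropping `e_j^↓` that moves the ball in column `c`. -/
def DownAt (j c : ℕ) (M M' : Arr) : Prop :=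
  (∀ t, rowHt M j t ≤ rowHt M j c) ∧ (∀ t, c < t → rowHt M j t < rowHt M j c) ∧
    M' = moveBall M (j + 1, c) (j, c)

/-- `M'` arises from `M` by a nontrivial `f_i^→` that moves the ball in row `s + 1`. -/
def RightAt (i s : ℕ) (M M' : Arr) : Prop :=
  (∀ u, colHt M i u ≤ colHt M i s) ∧ (∀ u, s < u → colHt M i u < colHt M i s) ∧
    M' = moveBall M (s + 1, i) (s + 1, i + 1)

theorem InGrid.bounds {L n : ℕ} {M : Arr} (h : InGrid L n M) {r c : ℕ} (hb : (r, c) ∈ M) :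
    (1 ≤ r ∧ r ≤ L) ∧ 1 ≤ c ∧ c ≤ n := by
  simpa using h hb

theorem ind_nonneg (M : Arr) (r c : ℕ) : 0 ≤ ind M r c := by
  unfold ind; split_ifs <;> simp

theorem ind_le_one (M : Arr) (r c : ℕ) : ind M r c ≤ 1 := by
  unfold ind; split_ifs <;> simp

theorem ind_eq_one {M : Arr} {r c : ℕ} : ind M r c = 1 ↔ (r, c) ∈ M := by
  unfold ind; split_ifs <;> simp_all

theorem ind_eq_zero {M : Arr} {r c : ℕ} : ind M r c = 0 ↔ (r, c) ∉ M := by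
  unfold ind; split_ifs <;> simp_all

theorem rowTail_succ (M : Arr) (r t : ℕ) : rowTail M r t = rowTail M r (t + 1) + ind M r t := by
  unfold rowTail ind
  split_ifs with h
  · have : (M.filter fun b => b.1 = r ∧ t ≤ b.2) =
        insert (r, t) (M.filter fun b => b.1 = r ∧ t + 1 ≤ b.2) := by
      ext ⟨x, y⟩
      simp only [Finset.mem_filter, Finset.mem_insert, Prod.mk.injEq]
      constructor
      · rintro ⟨h1, h2, h3⟩
        by_cases h4 : y = t
        · left; omega
        · right; exact ⟨h1, h2, by omega⟩
      · rintro (⟨rfl, rfl⟩ | ⟨h1, h2, h3⟩)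
        · exact ⟨h, rfl, le_rfl⟩
        · exact ⟨h1, h2, by omega⟩
    rw [this, Finset.card_insert_of_notMem (by simp)]
    push_cast; rfl
  · have : (M.filter fun b => b.1 = r ∧ t ≤ b.2) = M.filter fun b => b.1 = r ∧ t + 1 ≤ b.2 := by
      ext ⟨x, y⟩
      simp only [Finset.mem_filter]
      constructor
      · rintro ⟨h1, h2, h3⟩
        refine ⟨h1, h2, ?_⟩
        by_contra h4
        have : y = t := by omega
        subst h2 this
        exact h h1
      · rintro ⟨h1, h2, h3⟩
        exact ⟨h1, h2, by omega⟩
    rw [this]; simp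

theorem colHead_succ (M : Arr) (c s : ℕ) :
    colHead M c (s + 1) = colHead M c s + ind M (s + 1) c := by
  unfold colHead ind
  split_ifs with h
  · have : (M.filter fun b => b.2 = c ∧ b.1 ≤ s + 1) =
        insert (s + 1, c) (M.filter fun b => b.2 = c ∧ b.1 ≤ s) := by
      ext ⟨x, y⟩
      simp only [Finset.mem_filter, Finset.mem_insert, Prod.mk.injEq]
      constructor
      · rintro ⟨h1, h2, h3⟩
        by_cases h4 : x = s + 1
        · left; omega
        · right; exact ⟨h1, h2, by omega⟩
      · rintro (⟨rfl, rfl⟩ | ⟨h1, h2, h3⟩)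
        · exact ⟨h, rfl, le_rfl⟩
        · exact ⟨h1, h2, by omega⟩
    rw [this, Finset.card_insert_of_notMem (by simp)]
    push_cast; rfl
  · have : (M.filter fun b => b.2 = c ∧ b.1 ≤ s + 1) = M.filter fun b => b.2 = c ∧ b.1 ≤ s := by
      ext ⟨x, y⟩
      simp only [Finset.mem_filter]
      constructor
      · rintro ⟨h1, h2, h3⟩
        refine ⟨h1, h2, ?_⟩
        by_contra h4
        have : x = s + 1 := by omega
        subst h2 this
        exact h h1
      · rintro ⟨h1, h2, h3⟩
        exact ⟨h1, h2, by omega⟩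
    rw [this]; simp

theorem rowHt_succ (M : Arr) (j t : ℕ) :
    rowHt M j t = rowHt M j (t + 1) + ind M (j + 1) t - ind M j t := by
  unfold rowHt; rw [rowTail_succ M (j + 1), rowTail_succ M j]; ring

theorem colHt_succ (M : Arr) (i s : ℕ) :
    colHt M i (s + 1) = colHt M i s + ind M (s + 1) (i + 1) - ind M (s + 1) i := by
  unfold colHt; rw [colHead_succ M (i + 1), colHead_succ M i]; ring

theorem rowTail_eq_zero {L n : ℕ} {M : Arr} (h : InGrid L n M) (r : ℕ) {t : ℕ} (ht : n < t) :
    rowTail M r t = 0 := by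
  unfold rowTail
  rw [Nat.cast_eq_zero, Finset.card_eq_zero, Finset.filter_eq_empty_iff]
  rintro ⟨x, y⟩ hb ⟨-, h2⟩
  have := h.bounds hb
  simp only at h2; omega

theorem rowHt_eq_zero {L n : ℕ} {M : Arr} (h : InGrid L n M) (j : ℕ) {t : ℕ} (ht : n < t) :
    rowHt M j t = 0 := by
  rw [rowHt, rowTail_eq_zero h _ ht, rowTail_eq_zero h _ ht, sub_zero]

theorem colHead_zero {L n : ℕ} {M : Arr} (h : InGrid L n M) (c : ℕ) : colHead M c 0 = 0 := by
  unfold colHead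
  rw [Nat.cast_eq_zero, Finset.card_eq_zero, Finset.filter_eq_empty_iff]
  rintro ⟨x, y⟩ hb ⟨-, h2⟩
  have := h.bounds hb
  simp only at h2; omega

theorem colHt_zero {L n : ℕ} {M : Arr} (h : InGrid L n M) (i : ℕ) : colHt M i 0 = 0 := by
  rw [colHt, colHead_zero h, colHead_zero h, sub_zero]

theorem colHead_of_le {L n : ℕ} {M : Arr} (h : InGrid L n M) (c : ℕ) {s : ℕ} (hs : L ≤ s) :
    colHead M c s = colHead M c L := by
  unfold colHead
  congr 2
  ext ⟨x, y⟩
  simp only [Finset.mem_filter]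
  constructor
  · rintro ⟨h1, h2, -⟩
    exact ⟨h1, h2, (h.bounds h1).1.2⟩
  · rintro ⟨h1, h2, h3⟩
    exact ⟨h1, h2, by omega⟩

theorem colHt_of_le {L n : ℕ} {M : Arr} (h : InGrid L n M) (i : ℕ) {s : ℕ} (hs : L ≤ s) :
    colHt M i s = colHt M i L := by
  rw [colHt, colHead_of_le h _ hs, colHead_of_le h _ hs, colHt]

/-! ### Moving balls -/

theorem mem_moveBall {M : Arr} {b b' x : ℕ × ℕ} :
    x ∈ moveBall M b b' ↔ x = b' ∨ (x ≠ b ∧ x ∈ M) := by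
  simp [moveBall]

theorem card_filter_moveBall {M : Arr} {b b' : ℕ × ℕ} (hb : b ∈ M) (hb' : b' ∉ M)
    (p : ℕ × ℕ → Prop) [DecidablePred p] :
    (((moveBall M b b').filter p).card : ℤ) =
      (M.filter p).card + (if p b' then 1 else 0) - (if p b then 1 else 0) := by
  have e : (M.filter p).card = ((M.erase b).filter p).card + (if p b then 1 else 0) := by
    conv_lhs => rw [← Finset.insert_erase hb]
    rw [Finset.filter_insert]
    split_ifs
    · rw [Finset.card_insert_of_notMem (by simp)]
    · rfl
  rw [moveBall, Finset.filter_insert, e]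
  split_ifs <;> first
    | (rw [Finset.card_insert_of_notMem (by simp [hb'])]; push_cast; ring)
    | (push_cast; ring)

section Moves

variable {M M' : Arr} {i j c s : ℕ}

theorem DownAt.mem_upper (h : DownAt j c M M') : (j + 1, c) ∈ M := by
  have h1 := h.2.1 (c + 1) (by omega)
  have h2 := rowHt_succ M j c
  have h3 := ind_nonneg M j c
  rw [← ind_eq_one]
  have := ind_le_one M (j + 1) c
  omega

theorem DownAt.notMem_lower (h : DownAt j c M M') : (j, c) ∉ M := by
  have h1 := h.2.1 (c + 1) (by omega)
  have h2 := rowHt_succ M j c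
  have h3 := ind_nonneg M j c
  rw [← ind_eq_zero]
  have := ind_le_one M (j + 1) c
  omega

theorem RightAt.mem_left (h : RightAt i s M M') : (s + 1, i) ∈ M := by
  have h1 := h.2.1 (s + 1) (by omega)
  have h2 := colHt_succ M i s
  have h3 := ind_nonneg M (s + 1) (i + 1)
  rw [← ind_eq_one]
  have := ind_le_one M (s + 1) i
  omega

theorem RightAt.notMem_right (h : RightAt i s M M') : (s + 1, i + 1) ∉ M := by
  have h1 := h.2.1 (s + 1) (by omega)
  have h2 := colHt_succ M i s
  have h3 := ind_nonneg M (s + 1) (i + 1)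
  rw [← ind_eq_zero]
  have := ind_le_one M (s + 1) i
  omega

theorem DownAt.rowTail_eq (h : DownAt j c M M') (r t : ℕ) : rowTail M' r t = rowTail M r t +
    (if j = r ∧ t ≤ c then 1 else 0) - (if j + 1 = r ∧ t ≤ c then 1 else 0) := by
  rw [h.2.2, rowTail, card_filter_moveBall h.mem_upper h.notMem_lower, rowTail]

theorem DownAt.rowHt_eq (h : DownAt j c M M') (t : ℕ) :
    rowHt M' j t = rowHt M j t - if t ≤ c then 2 else 0 := by
  rw [rowHt, rowHt, h.rowTail_eq, h.rowTail_eq]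
  by_cases h1 : t ≤ c <;> simp [h1]; ring

theorem DownAt.colHead_eq (h : DownAt j c M M') (a s : ℕ) : colHead M' a s = colHead M a s +
    if c = a ∧ s = j then 1 else 0 := by
  rw [h.2.2, colHead, card_filter_moveBall h.mem_upper h.notMem_lower, colHead]
  simp only
  split_ifs <;> omega

theorem DownAt.colHt_eq (h : DownAt j c M M') (i s : ℕ) : colHt M' i s = colHt M i s +
    (if c = i + 1 ∧ s = j then 1 else 0) - (if c = i ∧ s = j then 1 else 0) := by
  rw [colHt, colHt, h.colHead_eq, h.colHead_eq]; ring

theorem RightAt.rowTail_eq (h : RightAt i s M M') (r t : ℕ) : rowTail M' r t = rowTail M r t +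
    if r = s + 1 ∧ t = i + 1 then 1 else 0 := by
  rw [h.2.2, rowTail, card_filter_moveBall h.mem_left h.notMem_right, rowTail]
  simp only
  split_ifs <;> omega

theorem RightAt.rowHt_eq (h : RightAt i s M M') (j t : ℕ) : rowHt M' j t = rowHt M j t +
    (if j = s ∧ t = i + 1 then 1 else 0) - (if j = s + 1 ∧ t = i + 1 then 1 else 0) := by
  rw [rowHt, rowHt, h.rowTail_eq, h.rowTail_eq]
  simp only [Nat.add_right_cancel_iff]; ring

theorem DownAt.inGrid {L n : ℕ} (h : DownAt j c M M') (hM : InGrid L n M) (hj : 1 ≤ j) :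
    InGrid L n M' := by
  intro x hx
  rw [h.2.2, mem_moveBall] at hx
  rcases hx with rfl | ⟨-, hx⟩
  · have := hM.bounds h.mem_upper
    simp only [Finset.mem_product, Finset.mem_Icc]; omega
  · exact hM hx

theorem DownAt.inGrid_of {L n : ℕ} (h : DownAt j c M M') (hM : InGrid L n M') (hj : j + 1 ≤ L) :
    InGrid L n M := by
  intro x hx
  by_cases hx' : x = (j + 1, c)
  · have : (j, c) ∈ M' := by rw [h.2.2, mem_moveBall]; simp
    have := hM.bounds this
    subst hx'
    simp only [Finset.mem_product, Finset.mem_Icc]; omega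
  · exact hM (by rw [h.2.2, mem_moveBall]; exact Or.inr ⟨hx', hx⟩)

theorem RightAt.inGrid {L n : ℕ} (h : RightAt i s M M') (hM : InGrid L n M) (hi : i + 1 ≤ n) :
    InGrid L n M' := by
  intro x hx
  rw [h.2.2, mem_moveBall] at hx
  rcases hx with rfl | ⟨-, hx⟩
  · have := hM.bounds h.mem_left
    simp only [Finset.mem_product, Finset.mem_Icc]; omega
  · exact hM hx

end Moves

/-! ### The operators in terms of heights -/

theorem eDown_eq_of_downAt {L n j c : ℕ} {M M' : Arr} (hM : InGrid L n M) (hj : 1 ≤ j)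
    (hjL : j + 1 ≤ L) (h : DownAt j c M M') : eDown L n j M = M' := by
  have hc := (hM.bounds h.mem_upper).2
  have hh : IsHeight M (fun p => (j + 1, p)) (fun p => (j, p)) (rowHt M j) n :=
    fun p _ _ => rowHt_succ M j p
  have := foldl_pairStep_open hh hc.1 hc.2 (fun p _ _ => h.1 p) (fun p hp _ => h.2.1 p hp)
  rw [eDown, unmatched_colReading L n j hj hjL, this, h.2.2]

theorem eDown_eq_self {L n j : ℕ} {M : Arr} (hM : InGrid L n M) (hj : 1 ≤ j)
    (hjL : j + 1 ≤ L) (h : ∀ t, rowHt M j t ≤ 0) : eDown L n j M = M := by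
  have hh : IsHeight M (fun p => (j + 1, p)) (fun p => (j, p)) (rowHt M j) n :=
    fun p _ _ => rowHt_succ M j p
  have := foldl_pairStep_open_null hh (fun p _ _ => by
    rw [rowHt_eq_zero hM j (show n < n + 1 by omega)]; exact h p)
  rw [eDown, unmatched_colReading L n j hj hjL, this]
  rfl

theorem isHeight_colHt (L : ℕ) (M : Arr) (i : ℕ) :
    IsHeight M (fun p => (L + 1 - p, i + 1)) (fun p => (L + 1 - p, i))
      (fun p => colHt M i (L + 1 - p)) L := by
  intro p h1 h2
  have e : L + 1 - p = (L + 1 - (p + 1)) + 1 := by omega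
  have h3 := colHt_succ M i (L + 1 - (p + 1))
  rw [← e] at h3
  exact h3

theorem fRight_eq_of_rightAt {L n i s : ℕ} {M M' : Arr} (hM : InGrid L n M) (hi : 1 ≤ i)
    (hin : i + 1 ≤ n) (h : RightAt i s M M') : fRight L n i M = M' := by
  have hc := (hM.bounds h.mem_left).1
  have e : L + 1 - (L - s + 1) = s := by omega
  have e' : L + 1 - (L - s) = s + 1 := by omega
  have := foldl_pairStep_close (isHeight_colHt L M i) (c := L - s) (by omega) (by omega)
    (fun p h1 h2 => by simp only [e]; exact h.2.1 _ (by omega))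
    (fun p h1 h2 => by simp only [e]; exact h.1 _)
  rw [fRight, unmatched_rowReading L n i hi hin, this, h.2.2]
  simp only [e']

theorem fRight_eq_self {L n i : ℕ} {M : Arr} (hi : 1 ≤ i)
    (hin : i + 1 ≤ n) (h : ∀ s, colHt M i s ≤ colHt M i L) : fRight L n i M = M := by
  have := foldl_pairStep_close_null (isHeight_colHt L M i) (fun p _ _ => by
    simpa using h (L + 1 - p))
  rw [fRight, unmatched_rowReading L n i hi hin, this]
  rfl

/-! ### Row and column operators commute -/

section Commute

variable {M M₁ M₂ M' : Arr} {i j c s : ℕ}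

/-- The move changes row heights only at t = i + 1, and by one; there the heights at i and i + 2
together with the extremality of s keep the bound. The case K = 0 says that column operators
preserve `Null`. -/
theorem RightAt.rowHt_le_iff (h : RightAt i s M M') (hj : 1 ≤ j) (K : ℤ) :
    (∀ t, rowHt M' j t ≤ K) ↔ ∀ t, rowHt M j t ≤ K := by
  have hA := ind_eq_one.2 h.mem_left
  have hB := ind_eq_zero.2 h.notMem_right
  have g1 := colHt_succ M i s
  constructor
  · intro hK t
    have ht := hK t
    rw [h.rowHt_eq] at ht
    by_cases hs : j = s + 1 ∧ t = i + 1
    · obtain ⟨rfl, rfl⟩ := hs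
      have k1 := hK i
      have k2 := hK (i + 1 + 1)
      rw [h.rowHt_eq] at k1 k2
      simp at k1 k2 ht
      have a1 := rowHt_succ M (s + 1) i
      have a2 := rowHt_succ M (s + 1) (i + 1)
      have g2 := colHt_succ M i (s + 1)
      have g3 := h.2.1 (s + 1 + 1) (by omega)
      have := ind_nonneg M (s + 1 + 1) i
      have := ind_le_one M (s + 1 + 1) (i + 1)
      omega
    · rw [if_neg hs] at ht
      split_ifs at ht <;> omega
  · intro hK t
    rw [h.rowHt_eq]
    have ht := hK t
    by_cases hs : j = s ∧ t = i + 1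
    · obtain ⟨rfl, rfl⟩ := hs
      obtain ⟨j, rfl⟩ : ∃ k, j = k + 1 := ⟨j - 1, by omega⟩
      have k1 := hK i
      have k2 := hK (i + 1 + 1)
      simp
      have a1 := rowHt_succ M (j + 1) i
      have a2 := rowHt_succ M (j + 1) (i + 1)
      have g2 := colHt_succ M i j
      have g3 := h.1 j
      have := ind_nonneg M (j + 1) (i + 1)
      have := ind_le_one M (j + 1) i
      have := ind_le_one M (j + 1) (i + 1)
      omega
    · rw [if_neg hs]
      split_ifs <;> omega

/-- The transposed statement. It shows that droppings preserve sources of the crystal graph, and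
also the triviality of a column operator. -/
theorem DownAt.colHt_le_iff (h : DownAt j c M M') (hj : 1 ≤ j) (K : ℤ) :
    (∀ u, colHt M' i u ≤ K) ↔ ∀ u, colHt M i u ≤ K := by
  have hA := ind_eq_one.2 h.mem_upper
  have hB := ind_eq_zero.2 h.notMem_lower
  have g1 := rowHt_succ M j c
  obtain ⟨j, rfl⟩ : ∃ k, j = k + 1 := ⟨j - 1, by omega⟩
  constructor
  · intro hK u
    have hu := hK u
    rw [h.colHt_eq] at hu
    by_cases hs : c = i ∧ u = j + 1
    · obtain ⟨rfl, rfl⟩ := hs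
      have k1 := hK j
      have k2 := hK (j + 1 + 1)
      rw [h.colHt_eq] at k1 k2
      simp at k1 k2 hu
      have a1 := colHt_succ M c j
      have a2 := colHt_succ M c (j + 1)
      have g2 := rowHt_succ M (j + 1) (c + 1)
      have g3 := h.2.1 (c + 1 + 1) (by omega)
      have := ind_nonneg M (j + 1) (c + 1)
      have := ind_le_one M (j + 1 + 1) (c + 1)
      have := ind_nonneg M (j + 1 + 1) (c + 1)
      omega
    · rw [if_neg hs] at hu
      split_ifs at hu <;> omega
  · intro hK u
    rw [h.colHt_eq]
    have hu := hK u
    by_cases hs : c = i + 1 ∧ u = j + 1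
    · obtain ⟨rfl, rfl⟩ := hs
      have k1 := hK j
      have k2 := hK (j + 1 + 1)
      simp
      have a1 := colHt_succ M i j
      have a2 := colHt_succ M i (j + 1)
      have g2 := rowHt_succ M (j + 1) i
      have g3 := h.1 i
      have := ind_nonneg M (j + 1 + 1) i
      have := ind_le_one M (j + 1 + 1) i
      have := ind_le_one M (j + 1) i
      omega
    · rw [if_neg hs]
      split_ifs <;> omega

theorem moveBall_comm {a a' b b' : ℕ × ℕ} (h1 : a ≠ b') (h2 : b ≠ a') :
    moveBall (moveBall M a a') b b' = moveBall (moveBall M b b') a a' := by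
  ext x
  simp only [mem_moveBall]
  grind

/-- The local confluence of a row dropping and a column operator. -/
theorem DownAt.diamond (h₁ : DownAt j c M M₁) (h₂ : RightAt i s M M₂) (hj : 1 ≤ j) :
    ∃ c' s' M₃, DownAt j c' M₂ M₃ ∧ RightAt i s' M₁ M₃ := by
  have d1 := ind_eq_one.2 h₁.mem_upper
  have d2 := ind_eq_zero.2 h₁.notMem_lower
  have r1 := ind_eq_one.2 h₂.mem_left
  have r2 := ind_eq_zero.2 h₂.notMem_right
  obtain ⟨j, rfl⟩ : ∃ k, j = k + 1 := ⟨j - 1, by omega⟩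
  -- Both moves aim at the same site, lower row and column i + 1. Extremality forces a ball in the
  -- upper row of column i; after either move the other operator selects that ball.
  by_cases sp1 : j + 1 = s + 1 ∧ c = i + 1
  · obtain ⟨hjs, rfl⟩ := sp1
    obtain rfl : j = s := by omega
    have a1 := rowHt_succ M (j + 1) i
    have a2 := rowHt_succ M (j + 1) (i + 1)
    have g1 := colHt_succ M i j
    have g2 := colHt_succ M i (j + 1)
    have k1 := h₂.2.1 (j + 1 + 1) (by omega)
    have k2 := h₁.1 i
    have := ind_le_one M (j + 1 + 1) i
    refine ⟨i, j + 1, moveBall M (j + 1 + 1, i) (j + 1, i + 1), ⟨?_, ?_, ?_⟩, ⟨?_, ?_, ?_⟩⟩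
    · intro t
      have := h₁.1 t
      rw [h₂.rowHt_eq, h₂.rowHt_eq]
      simp
      split_ifs <;> omega
    · intro t ht
      have := h₁.1 t
      have h3 := h₁.2.1 t
      rw [h₂.rowHt_eq, h₂.rowHt_eq]
      simp
      split_ifs with h4
      · subst h4; omega
      · have := h3 (by omega); omega
    · have hm : (j + 1 + 1, i) ∈ M := by rw [← ind_eq_one]; omega
      have := h₂.mem_left
      rw [h₂.2.2]
      ext ⟨x, y⟩
      simp only [mem_moveBall, Prod.mk.injEq, ne_eq]
      grind
    · intro u
      have := h₂.1 u
      rw [h₁.colHt_eq, h₁.colHt_eq]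
      simp
      split_ifs with h3
      · subst h3; omega
      · omega
    · intro u hu
      have := h₂.2.1 u (by omega)
      rw [h₁.colHt_eq, h₁.colHt_eq]
      simp
      split_ifs with h3
      · omega
      · omega
    · have := h₁.mem_upper
      rw [h₁.2.2]
      ext ⟨x, y⟩
      simp only [mem_moveBall, Prod.mk.injEq, ne_eq]
      grind
  -- Both operators select the same ball. In either order it ends in the lower row of column c + 1.
  by_cases sp2 : j + 1 = s ∧ c = i
  · obtain ⟨rfl, rfl⟩ := sp2
    have a1 := rowHt_succ M (j + 1) c
    have a2 := rowHt_succ M (j + 1) (c + 1)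
    have g1 := colHt_succ M c j
    have g2 := colHt_succ M c (j + 1)
    have k1 := h₂.1 j
    have k2 := h₁.2.1 (c + 1 + 1) (by omega)
    have := ind_nonneg M (j + 1) (c + 1)
    have hm : (j + 1, c + 1) ∉ M := by rw [← ind_eq_zero]; omega
    refine ⟨c + 1, j, moveBall M (j + 1 + 1, c) (j + 1, c + 1), ⟨?_, ?_, ?_⟩, ⟨?_, ?_, ?_⟩⟩
    · intro t
      have := h₁.1 t
      rw [h₂.rowHt_eq, h₂.rowHt_eq]
      simp
      split_ifs with h3
      · subst h3; omega
      · omega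
    · intro t ht
      have := h₁.2.1 t (by omega)
      rw [h₂.rowHt_eq, h₂.rowHt_eq]
      simp
      split_ifs with h3
      · omega
      · omega
    · have := h₂.notMem_right
      rw [h₂.2.2]
      ext ⟨x, y⟩
      simp only [mem_moveBall, Prod.mk.injEq, ne_eq]
      grind
    · intro u
      have := h₂.1 u
      rw [h₁.colHt_eq, h₁.colHt_eq]
      simp
      split_ifs with h3
      · omega
      · omega
    · intro u hu
      have := h₂.1 u
      have h4 := h₂.2.1 u
      rw [h₁.colHt_eq, h₁.colHt_eq]
      simp
      split_ifs with h3
      · subst h3; omega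
      · have := h4 (by omega); omega
    · have := h₁.notMem_lower
      rw [h₁.2.2]
      ext ⟨x, y⟩
      simp only [mem_moveBall, Prod.mk.injEq, ne_eq]
      grind
  -- The two remaining overlaps would put a ball on the empty target of the right move or of the
  -- dropping. In all other cases each operator keeps its choice after the other has acted.
  have n1 : ¬ (j + 1 + 1 = s + 1 ∧ c = i + 1) := by
    rintro ⟨e, rfl⟩
    rw [← e] at r2
    omega
  have n2 : ¬ (j + 1 = s + 1 ∧ c = i) := by
    rintro ⟨e, rfl⟩
    rw [← e] at r1
    omega
  refine ⟨c, s, moveBall M₂ (j + 1 + 1, c) (j + 1, c), ⟨?_, ?_, rfl⟩, ⟨?_, ?_, ?_⟩⟩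
  · intro t
    have h3 := h₁.1 t
    by_cases hs : j + 1 = s ∧ t = i + 1
    · obtain ⟨rfl, rfl⟩ := hs
      rw [h₂.rowHt_eq, h₂.rowHt_eq]
      have a1 := rowHt_succ M (j + 1) i
      have a2 := rowHt_succ M (j + 1) (i + 1)
      have g1 := colHt_succ M i j
      have k1 := h₂.1 j
      have k2 := h₁.1 (i + 1 + 1)
      have k3 := h₁.1 i
      have := ind_le_one M (j + 1) (i + 1)
      have := ind_le_one M (j + 1) i
      split_ifs <;> omega
    · rw [h₂.rowHt_eq, h₂.rowHt_eq]
      split_ifs <;> omega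
  · intro t ht
    have h3 := h₁.2.1 t ht
    by_cases hs : j + 1 = s ∧ t = i + 1
    · obtain ⟨rfl, rfl⟩ := hs
      rw [h₂.rowHt_eq, h₂.rowHt_eq]
      have a1 := rowHt_succ M (j + 1) i
      have a2 := rowHt_succ M (j + 1) (i + 1)
      have g1 := colHt_succ M i j
      have k1 := h₂.1 j
      have k2 := h₁.2.1 (i + 1 + 1) (by omega)
      have k3 := h₁.2.1 i (by omega)
      have := ind_le_one M (j + 1) (i + 1)
      have := ind_nonneg M (j + 1) (i + 1)
      have := ind_le_one M (j + 1) i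
      split_ifs <;> omega
    · rw [h₂.rowHt_eq, h₂.rowHt_eq]
      split_ifs <;> omega
  · intro u
    have h3 := h₂.1 u
    by_cases hs : c = i + 1 ∧ u = j + 1
    · obtain ⟨rfl, rfl⟩ := hs
      rw [h₁.colHt_eq, h₁.colHt_eq]
      have a1 := colHt_succ M i j
      have a2 := colHt_succ M i (j + 1)
      have g1 := rowHt_succ M (j + 1) i
      have k1 := h₂.1 j
      have k2 := h₂.1 (j + 1 + 1)
      have k3 := h₁.1 i
      have := ind_le_one M (j + 1 + 1) i
      have := ind_le_one M (j + 1) i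
      split_ifs <;> omega
    · rw [h₁.colHt_eq, h₁.colHt_eq]
      split_ifs <;> omega
  · intro u hu
    have h3 := h₂.2.1 u hu
    by_cases hs : c = i + 1 ∧ u = j + 1
    · obtain ⟨rfl, rfl⟩ := hs
      rw [h₁.colHt_eq, h₁.colHt_eq]
      have a1 := colHt_succ M i j
      have a2 := colHt_succ M i (j + 1)
      have g1 := rowHt_succ M (j + 1) i
      have k1 := h₂.2.1 j (by omega)
      have k2 := h₂.2.1 (j + 1 + 1) (by omega)
      have k3 := h₁.1 i
      have := ind_le_one M (j + 1 + 1) i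
      have := ind_le_one M (j + 1) i
      split_ifs <;> omega
    · rw [h₁.colHt_eq, h₁.colHt_eq]
      split_ifs <;> omega
  · rw [h₁.2.2, h₂.2.2]
    apply moveBall_comm <;> simp only [ne_eq, Prod.mk.injEq] <;> omega

end Commute

/-! ### Extremal positions of heights -/

theorem exists_last_argmax (h : ℕ → ℤ) (N : ℕ) (v : ℤ) (hv : ∀ t, N ≤ t → h t = v)
    (hex : ∃ t, v < h t) : ∃ c, (∀ t, h t ≤ h c) ∧ ∀ t, c < t → h t < h c := by
  obtain ⟨t₀, ht₀⟩ := hex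
  have ht₀N : t₀ < N := by
    by_contra hle
    rw [hv t₀ (by omega)] at ht₀; omega
  obtain ⟨m, hm, hmax⟩ := Finset.exists_max_image (Finset.range N) h ⟨t₀, by simpa⟩
  have hm' : ∀ t, h t ≤ h m := by
    intro t
    by_cases ht : t < N
    · exact hmax t (by simpa)
    · rw [hv t (by omega)]
      have := hmax t₀ (by simpa)
      omega
  obtain ⟨c, hc, hcmax⟩ := Finset.exists_max_image ((Finset.range N).filter fun t => h t = h m) id
    ⟨m, by simpa using hm⟩
  simp only [Finset.mem_filter, Finset.mem_range, id] at hc hcmax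
  refine ⟨c, fun t => by rw [hc.2]; exact hm' t, fun t ht => ?_⟩
  refine lt_of_le_of_ne (by rw [hc.2]; exact hm' t) fun he => ?_
  have : ¬ t < N := fun htN => by
    have := hcmax t ⟨htN, by omega⟩
    omega
  have h1 := hv t (by omega)
  have h2 := hm' t₀
  omega

theorem exists_first_argmax (h : ℕ → ℤ) (N : ℕ) (v : ℤ) (hv : ∀ t, N ≤ t → h t = v) :
    ∃ c, (∀ t, h t ≤ h c) ∧ ∀ t, t < c → h t < h c := by
  obtain ⟨m, hm, hmax⟩ := Finset.exists_max_image (Finset.range (N + 1)) h ⟨N, by simp⟩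
  have hm' : ∀ t, h t ≤ h m := by
    intro t
    by_cases ht : t < N + 1
    · exact hmax t (Finset.mem_range.2 ht)
    · rw [hv t (by omega), ← hv N le_rfl]
      exact hmax N (by simp)
  classical
  have hex : ∃ t, h t = h m := ⟨m, rfl⟩
  refine ⟨Nat.find hex, fun t => by rw [Nat.find_spec hex]; exact hm' t, fun t ht => ?_⟩
  rw [Nat.find_spec hex]
  exact lt_of_le_of_ne (hm' t) (Nat.find_min hex ht)

/-! ### Sequences of row operators -/

/-- No ball of row `j + 1` can be dropped. -/
def Null (j : ℕ) (M : Arr) : Prop := ∀ t, rowHt M j t ≤ 0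

/-- A nontrivial row dropping. -/
def Down (j : ℕ) (M N : Arr) : Prop := ∃ c, DownAt j c M N

/-- `a` consecutive nontrivial row droppings. -/
def DownN (j : ℕ) : ℕ → Arr → Arr → Prop
  | 0, M, N => M = N
  | a + 1, M, N => ∃ P, Down j M P ∧ DownN j a P N

/-- A maximal sequence of row droppings, of length `a`. -/
def DStar (j a : ℕ) (M N : Arr) : Prop := DownN j a M N ∧ Null j N

/-- A succession of maximal sequences of row droppings, with prescribed lengths. -/
def DSeq : List ℕ → List ℕ → Arr → Arr → Prop
  | [], [], M, N => M = N
  | j :: js, a :: as, M, N => ∃ M', DStar j a M M' ∧ DSeq js as M' N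
  | _, _, _, _ => False

/-- A succession of sequences of inverse row droppings, with prescribed lengths. -/
def UpSeq : List (ℕ × ℕ) → Arr → Arr → Prop
  | [], M, N => M = N
  | p :: ps, M, N => ∃ M', DownN p.1 p.2 M' M ∧ UpSeq ps M' N

/-! ### Row droppings are deterministic and reversible -/

theorem DownAt.unique {j c c' : ℕ} {M N N' : Arr} (h : DownAt j c M N) (h' : DownAt j c' M N') :
    N = N' := by
  have : c = c' := by
    rcases lt_trichotomy c c' with hl | hl | hl
    · have := h.2.1 _ hl; have := h'.1 c; omega
    · exact hl
    · have := h'.2.1 _ hl; have := h.1 c'; omega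
  rw [h.2.2, h'.2.2, this]

/-- Lowering the heights up to c by 2 turns the last maximum c into the first maximum c + 1, from
which the moved ball can be recovered. -/
theorem DownAt.reverse {j c : ℕ} {M N : Arr} (h : DownAt j c M N) :
    (∀ t, rowHt N j t ≤ rowHt N j (c + 1)) ∧ (∀ t, t ≤ c → rowHt N j t < rowHt N j (c + 1)) ∧
      M = moveBall N (j, c) (j + 1, c) := by
  have a1 := rowHt_succ M j c
  have d1 := ind_eq_one.2 h.mem_upper
  have d2 := ind_eq_zero.2 h.notMem_lower
  refine ⟨fun t => ?_, fun t ht => ?_, ?_⟩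
  · rw [h.rowHt_eq, h.rowHt_eq]
    have := h.1 t
    have := h.2.1 t
    split_ifs <;> omega
  · rw [h.rowHt_eq, h.rowHt_eq]
    have := h.1 t
    split_ifs <;> omega
  · have h1 := h.mem_upper
    have h2 := h.notMem_lower
    rw [h.2.2]
    ext ⟨x, y⟩
    simp only [mem_moveBall, Prod.mk.injEq, ne_eq]
    grind

/-- The inverse of a row dropping. -/
theorem downAt_moveBall {j c : ℕ} {N : Arr} (h1 : ∀ t, rowHt N j t ≤ rowHt N j (c + 1))
    (h2 : ∀ t, t ≤ c → rowHt N j t < rowHt N j (c + 1)) :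
    (j, c) ∈ N ∧ (j + 1, c) ∉ N ∧ DownAt j c (moveBall N (j, c) (j + 1, c)) N := by
  have a1 := rowHt_succ N j c
  have a2 := h2 c le_rfl
  have := ind_nonneg N (j + 1) c
  have := ind_le_one N j c
  have m1 : (j, c) ∈ N := by rw [← ind_eq_one]; omega
  have m2 : (j + 1, c) ∉ N := by rw [← ind_eq_zero]; omega
  have d1 := ind_eq_one.2 m1
  have d2 := ind_eq_zero.2 m2
  have key : ∀ t, rowHt (moveBall N (j, c) (j + 1, c)) j t =
      rowHt N j t + if t ≤ c then 2 else 0 := by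
    intro t
    rw [rowHt, rowHt, rowTail, rowTail, card_filter_moveBall m1 m2, card_filter_moveBall m1 m2,
      rowTail, rowTail]
    by_cases h : t ≤ c <;> simp [h]; ring
  refine ⟨m1, m2, fun t => ?_, fun t ht => ?_, ?_⟩
  · rw [key, key]
    have := h1 t
    have := h2 t
    split_ifs <;> omega
  · rw [key, key]
    have := h1 t
    split_ifs <;> omega
  · ext ⟨x, y⟩
    simp only [mem_moveBall, Prod.mk.injEq, ne_eq]
    grind

theorem DownAt.unique_left {j c c' : ℕ} {M M' N : Arr} (h : DownAt j c M N)
    (h' : DownAt j c' M' N) : M = M' := by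
  have h1 := h.reverse
  have h2 := h'.reverse
  have : c = c' := by
    rcases lt_trichotomy c c' with hl | hl | hl
    · have := h2.2.1 (c + 1) (by omega); have := h1.1 (c' + 1); omega
    · exact hl
    · have := h1.2.1 (c' + 1) (by omega); have := h2.1 (c + 1); omega
  rw [h1.2.2, h2.2.2, this]

theorem Down.not_null {L n j : ℕ} {M N : Arr} (hM : InGrid L n M) (h : Down j M N) :
    ¬ Null j M := by
  obtain ⟨c, h⟩ := h
  intro h0
  have h1 := h0 c
  have h2 := h.2.1 (c + n + 1) (by omega)
  rw [rowHt_eq_zero hM j (by omega)] at h2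
  omega

theorem exists_down {L n j : ℕ} {M : Arr} (hM : InGrid L n M) (h : ¬ Null j M) :
    ∃ N, Down j M N := by
  simp only [Null, not_forall, not_le] at h
  obtain ⟨c, h1, h2⟩ := exists_last_argmax (rowHt M j) (n + 1) 0
    (fun t ht => rowHt_eq_zero hM j (by omega)) h
  exact ⟨_, c, h1, h2, rfl⟩

theorem Down.inGrid {L n j : ℕ} {M N : Arr} (h : Down j M N) (hM : InGrid L n M) (hj : 1 ≤ j) :
    InGrid L n N := h.choose_spec.inGrid hM hj

theorem DownN.inGrid {L n j a : ℕ} {M N : Arr} (h : DownN j a M N) (hM : InGrid L n M)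
    (hj : 1 ≤ j) : InGrid L n N := by
  induction a generalizing M with
  | zero => exact h ▸ hM
  | succ a ih =>
    obtain ⟨M', h1, h2⟩ := h
    exact ih h2 (h1.inGrid hM hj)

theorem DownN.inGrid_of {L n j a : ℕ} {M N : Arr} (h : DownN j a M N) (hN : InGrid L n N)
    (hj : j + 1 ≤ L) : InGrid L n M := by
  induction a generalizing M with
  | zero => exact (show M = N from h) ▸ hN
  | succ a ih =>
    obtain ⟨M', ⟨c, h1⟩, h2⟩ := h
    exact h1.inGrid_of (ih h2) hj

theorem DSeq.inGrid {L n : ℕ} {js as : List ℕ} {M N : Arr} (h : DSeq js as M N)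
    (hM : InGrid L n M) (hj : ∀ j ∈ js, 1 ≤ j) : InGrid L n N := by
  induction js generalizing as M with
  | nil =>
    cases as with
    | nil => exact (show M = N from h) ▸ hM
    | cons => exact h.elim
  | cons j js ih =>
    cases as with
    | nil => exact h.elim
    | cons a as =>
      obtain ⟨M', h1, h2⟩ := h
      exact ih h2 (h1.1.inGrid hM (hj j (by simp))) fun j hj' => hj j (by simp [hj'])

theorem UpSeq.inGrid {L n : ℕ} {ps : List (ℕ × ℕ)} {M N : Arr} (h : UpSeq ps M N)
    (hM : InGrid L n M) (hj : ∀ p ∈ ps, p.1 + 1 ≤ L) : InGrid L n N := by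
  induction ps generalizing M with
  | nil => exact (show M = N from h) ▸ hM
  | cons p ps ih =>
    obtain ⟨M', h1, h2⟩ := h
    exact ih h2 (h1.inGrid_of hM (hj p (by simp))) fun q hq => hj q (by simp [hq])

theorem DStar.unique {L n j a a' : ℕ} {M N N' : Arr} (hM : InGrid L n M) (hj : 1 ≤ j)
    (h : DStar j a M N) (h' : DStar j a' M N') : a = a' ∧ N = N' := by
  induction a generalizing M a' with
  | zero =>
    obtain ⟨h1, h2⟩ := h
    obtain rfl : M = N := h1
    cases a' with
    | zero => exact ⟨rfl, h'.1⟩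
    | succ a' =>
      obtain ⟨⟨M', h3, -⟩, -⟩ := h'
      exact (h3.not_null hM h2).elim
  | succ a ih =>
    obtain ⟨⟨M', h1, h2⟩, h3⟩ := h
    cases a' with
    | zero =>
      obtain ⟨h4, h5⟩ := h'
      obtain rfl : M = N' := h4
      exact (h1.not_null hM h5).elim
    | succ a' =>
      obtain ⟨⟨M'', h4, h5⟩, h6⟩ := h'
      obtain ⟨c, hc⟩ := h1
      obtain ⟨c', hc'⟩ := h4
      obtain rfl := hc.unique hc'
      obtain ⟨rfl, rfl⟩ := ih (hc.inGrid hM hj) ⟨h2, h3⟩ ⟨h5, h6⟩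
      exact ⟨rfl, rfl⟩

theorem DSeq.unique {L n : ℕ} {js as as' : List ℕ} {M N N' : Arr} (hM : InGrid L n M)
    (hj : ∀ j ∈ js, 1 ≤ j) (h : DSeq js as M N) (h' : DSeq js as' M N') : as = as' ∧ N = N' := by
  induction js generalizing as as' M with
  | nil =>
    cases as with
    | nil =>
      cases as' with
      | nil => exact ⟨rfl, (show M = N from h).symm.trans h'⟩
      | cons => exact h'.elim
    | cons => exact h.elim
  | cons j js ih =>
    cases as with
    | nil => exact h.elim
    | cons a as =>
      cases as' with
      | nil => exact h'.elim
      | cons a' as' =>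
        obtain ⟨M', h1, h2⟩ := h
        obtain ⟨M'', h3, h4⟩ := h'
        have hj1 := hj j (by simp)
        obtain ⟨rfl, rfl⟩ := h1.unique hM hj1 h3
        obtain ⟨rfl, rfl⟩ := ih (h1.1.inGrid hM hj1) (fun j hj' => hj j (by simp [hj'])) h2 h4
        exact ⟨rfl, rfl⟩

theorem DownN.unique_left {j a : ℕ} {M M' N : Arr} (h : DownN j a M N) (h' : DownN j a M' N) :
    M = M' := by
  induction a generalizing M M' with
  | zero => exact (show M = N from h).trans (show M' = N from h').symm
  | succ a ih =>
    obtain ⟨A, ⟨c, h1⟩, h2⟩ := h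
    obtain ⟨A', ⟨c', h3⟩, h4⟩ := h'
    obtain rfl := ih h2 h4
    exact h1.unique_left h3

theorem UpSeq.unique {ps : List (ℕ × ℕ)} {M N N' : Arr} (h : UpSeq ps M N) (h' : UpSeq ps M N') :
    N = N' := by
  induction ps generalizing M with
  | nil => exact (show M = N from h).symm.trans h'
  | cons p ps ih =>
    obtain ⟨A, h1, h2⟩ := h
    obtain ⟨A', h3, h4⟩ := h'
    obtain rfl := h1.unique_left h3
    exact ih h2 h4

theorem DSeq.append {js js' as as' : List ℕ} {M N P : Arr} (h : DSeq js as M N)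
    (h' : DSeq js' as' N P) : DSeq (js ++ js') (as ++ as') M P := by
  induction js generalizing as M with
  | nil =>
    cases as with
    | nil => obtain rfl : M = N := h; exact h'
    | cons => exact h.elim
  | cons j js ih =>
    cases as with
    | nil => exact h.elim
    | cons a as =>
      obtain ⟨M', h1, h2⟩ := h
      exact ⟨M', h1, ih h2⟩

theorem DSeq.of_append {js js' as : List ℕ} {M N : Arr} (h : DSeq (js ++ js') as M N) :
    ∃ as₁ as₂ P, as = as₁ ++ as₂ ∧ DSeq js as₁ M P ∧ DSeq js' as₂ P N := by
  induction js generalizing as M with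
  | nil => exact ⟨[], as, M, rfl, rfl, h⟩
  | cons j js ih =>
    cases as with
    | nil => exact h.elim
    | cons a as =>
      obtain ⟨M', h1, h2⟩ := h
      obtain ⟨as₁, as₂, P, rfl, h3, h4⟩ := ih h2
      exact ⟨a :: as₁, as₂, P, rfl, ⟨M', h1, h3⟩, h4⟩

/-! ### Transport along column operators -/

section Transport

variable {L n i : ℕ}

theorem fRight_cases {M : Arr} (hM : InGrid L n M) (hi : 1 ≤ i) (hin : i + 1 ≤ n) :
    ((∀ s, colHt M i s ≤ colHt M i L) ∧ fRight L n i M = M) ∨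
      ∃ s, RightAt i s M (fRight L n i M) := by
  by_cases h : ∀ s, colHt M i s ≤ colHt M i L
  · exact Or.inl ⟨h, fRight_eq_self hi hin h⟩
  · simp only [not_forall, not_le] at h
    obtain ⟨s, h1, h2⟩ := exists_last_argmax (colHt M i) L _ (fun t ht => colHt_of_le hM i ht) h
    have hr : RightAt i s M _ := ⟨h1, h2, rfl⟩
    refine Or.inr ⟨s, ?_⟩
    rw [fRight_eq_of_rightAt hM hi hin hr]
    exact hr

theorem fRight_inGrid {M : Arr} (hM : InGrid L n M) (hi : 1 ≤ i) (hin : i + 1 ≤ n) :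
    InGrid L n (fRight L n i M) := by
  rcases fRight_cases hM hi hin with ⟨-, h⟩ | ⟨s, h⟩
  · rw [h]; exact hM
  · exact h.inGrid hM hin

theorem Null.fRight {j : ℕ} {M : Arr} (h : Null j M) (hM : InGrid L n M) (hi : 1 ≤ i)
    (hin : i + 1 ≤ n) (hj : 1 ≤ j) : Null j (fRight L n i M) := by
  rcases fRight_cases hM hi hin with ⟨-, h'⟩ | ⟨s, h'⟩
  · rw [h']; exact h
  · exact (h'.rowHt_le_iff hj 0).2 h

theorem DownAt.colHead_top {j c : ℕ} {M N : Arr} (h : DownAt j c M N) (hjL : j + 1 ≤ L) (a : ℕ) :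
    colHead N a L = colHead M a L := by
  rw [h.colHead_eq, if_neg (by omega), add_zero]

/-- A column operator is trivial when its height is bounded by its value at the top, and a dropping
preserves both the bound and that value. In the nontrivial case the diamond applies. -/
theorem Down.fRight {j : ℕ} {M N : Arr} (h : Down j M N) (hM : InGrid L n M) (hi : 1 ≤ i)
    (hin : i + 1 ≤ n) (hj : 1 ≤ j) (hjL : j + 1 ≤ L) :
    Down j (fRight L n i M) (fRight L n i N) := by
  obtain ⟨c, h⟩ := h
  rcases fRight_cases hM hi hin with ⟨h1, h'⟩ | ⟨s, h'⟩
  · have h2 : ∀ s, colHt N i s ≤ colHt N i L := by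
      rw [show colHt N i L = colHt M i L by
        rw [colHt, colHt, h.colHead_top hjL, h.colHead_top hjL]]
      exact (h.colHt_le_iff hj _).2 h1
    rw [h', fRight_eq_self hi hin h2]
    exact ⟨c, h⟩
  · obtain ⟨c', s', M₃, h3, h4⟩ := h.diamond h' hj
    rw [fRight_eq_of_rightAt (h.inGrid hM hj) hi hin h4]
    exact ⟨c', h3⟩

theorem DownN.fRight {j a : ℕ} {M N : Arr} (h : DownN j a M N) (hM : InGrid L n M) (hi : 1 ≤ i)
    (hin : i + 1 ≤ n) (hj : 1 ≤ j) (hjL : j + 1 ≤ L) :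
    DownN j a (fRight L n i M) (fRight L n i N) := by
  induction a generalizing M with
  | zero => exact congrArg _ h
  | succ a ih =>
    obtain ⟨M', h1, h2⟩ := h
    exact ⟨_, h1.fRight hM hi hin hj hjL, ih h2 (h1.inGrid hM hj)⟩

theorem DSeq.fRight {js as : List ℕ} {M N : Arr} (h : DSeq js as M N) (hM : InGrid L n M)
    (hi : 1 ≤ i) (hin : i + 1 ≤ n) (hj : ∀ j ∈ js, 1 ≤ j ∧ j + 1 ≤ L) :
    DSeq js as (fRight L n i M) (fRight L n i N) := by
  induction js generalizing as M with
  | nil =>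
    cases as with
    | nil => exact congrArg _ (show M = N from h)
    | cons => exact h.elim
  | cons j js ih =>
    cases as with
    | nil => exact h.elim
    | cons a as =>
      obtain ⟨M', h1, h2⟩ := h
      have hj1 := hj j (by simp)
      have hM' := h1.1.inGrid hM hj1.1
      exact ⟨_, ⟨h1.1.fRight hM hi hin hj1.1 hj1.2, h1.2.fRight hM' hi hin hj1.1⟩,
        ih h2 hM' fun j hj' => hj j (by simp [hj'])⟩

theorem UpSeq.fRight {ps : List (ℕ × ℕ)} {M N : Arr} (h : UpSeq ps M N) (hM : InGrid L n M)
    (hi : 1 ≤ i) (hin : i + 1 ≤ n) (hj : ∀ p ∈ ps, 1 ≤ p.1 ∧ p.1 + 1 ≤ L) :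
    UpSeq ps (fRight L n i M) (fRight L n i N) := by
  induction ps generalizing M with
  | nil => exact congrArg _ (show M = N from h)
  | cons p ps ih =>
    obtain ⟨M', h1, h2⟩ := h
    have hj1 := hj p (by simp)
    have hM' := h1.inGrid_of hM hj1.2
    exact ⟨_, h1.fRight hM' hi hin hj1.1 hj1.2, ih h2 hM' fun q hq => hj q (by simp [hq])⟩

end Transport

/-! ### Maximal row droppings -/

theorem rowTail_nonneg (M : Arr) (r t : ℕ) : 0 ≤ rowTail M r t := Int.natCast_nonneg _

theorem rowTail_antitone (M : Arr) (r : ℕ) : Antitone (rowTail M r) :=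
  antitone_nat_of_succ_le fun t => by
    rw [rowTail_succ M r t]; have := ind_nonneg M r t; omega

/-- Each nontrivial dropping removes a ball from row j + 1, so any k at least the size of that row
exhausts the droppings. -/
theorem exists_dStar_iterate {L n j : ℕ} (hj : 1 ≤ j) (hjL : j + 1 ≤ L) (k : ℕ) (M : Arr)
    (hM : InGrid L n M) (hk : rowTail M (j + 1) 0 ≤ k) :
    ∃ a, DStar j a M ((eDown L n j)^[k] M) := by
  by_cases h : Null j M
  · have : (eDown L n j)^[k] M = M := Function.iterate_fixed (eDown_eq_self hM hj hjL h) k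
    rw [this]
    exact ⟨0, rfl, h⟩
  induction k generalizing M with
  | zero =>
    refine (h fun t => ?_).elim
    have h1 := rowTail_antitone M (j + 1) (Nat.zero_le t)
    have h2 := rowTail_nonneg M j t
    rw [rowHt]; push_cast at hk; omega
  | succ k ih =>
    obtain ⟨M', c, h1⟩ := exists_down hM h
    rw [Function.iterate_succ_apply, eDown_eq_of_downAt hM hj hjL h1]
    have hM' := h1.inGrid hM hj
    have hk' : rowTail M' (j + 1) 0 ≤ k := by
      rw [h1.rowTail_eq]; simp; push_cast at hk; omega
    by_cases h0 : Null j M'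
    · have : (eDown L n j)^[k] M' = M' := Function.iterate_fixed (eDown_eq_self hM' hj hjL h0) k
      rw [this]
      exact ⟨1, ⟨M', ⟨c, h1⟩, rfl⟩, h0⟩
    · obtain ⟨a, ha⟩ := ih M' hM' hk' h0
      exact ⟨a + 1, ⟨M', ⟨c, h1⟩, ha.1⟩, ha.2⟩

theorem exists_dStar_eDownStar {L n j : ℕ} (hj : 1 ≤ j) (hjL : j + 1 ≤ L) {M : Arr}
    (hM : InGrid L n M) : ∃ a, DStar j a M (eDownStar L n j M) :=
  exists_dStar_iterate hj hjL M.card M hM (by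
    unfold rowTail; exact_mod_cast Finset.card_filter_le _ _)

theorem exists_dSeq {L n : ℕ} (js : List ℕ) (hj : ∀ j ∈ js, 1 ≤ j ∧ j + 1 ≤ L) {M : Arr}
    (hM : InGrid L n M) : ∃ as N, DSeq js as M N := by
  induction js generalizing M with
  | nil => exact ⟨[], M, rfl⟩
  | cons j js ih =>
    have hj1 := hj j (by simp)
    obtain ⟨a, ha⟩ := exists_dStar_eDownStar hj1.1 hj1.2 hM
    obtain ⟨as, N, h⟩ := ih (fun j hj' => hj j (by simp [hj'])) (ha.1.inGrid hM hj1.1)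
    exact ⟨a :: as, N, _, ha, h⟩

/-- The effect of a maximal sequence of row droppings on the tails of the rows: the tails of the
dropped balls form the least antitone nonnegative function above the height. -/
theorem DStar.exists_tail {L n j a : ℕ} {M N : Arr} (h : DStar j a M N) (hM : InGrid L n M)
    (hj : 1 ≤ j) : ∃ F : ℕ → ℤ,
      (∀ r t, rowTail N r t =
        rowTail M r t + (if j = r then F t else 0) - (if j + 1 = r then F t else 0)) ∧
      Antitone F ∧ (∀ t, 0 ≤ F t) ∧ (∀ t, rowHt M j t ≤ F t) ∧
      ∀ K : ℕ → ℤ, Antitone K → (∀ t, 0 ≤ K t) → (∀ t, rowHt M j t ≤ K t) → ∀ t, F t ≤ K t := by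
  obtain ⟨h1, h0⟩ := h
  induction a generalizing M with
  | zero =>
    obtain rfl : M = N := h1
    exact ⟨fun _ => 0, by simp, antitone_const, by simp, h0, fun K _ h2 _ => h2⟩
  | succ a ih =>
    obtain ⟨M', ⟨c, h2⟩, h3⟩ := h1
    obtain ⟨F, f1, f2, f3, f4, f5⟩ := ih (h2.inGrid hM hj) h3
    have hpos : 1 ≤ rowHt M j c := by
      have := h2.2.1 (c + n + 1) (by omega)
      rw [rowHt_eq_zero hM j (by omega)] at this
      omega
    have a1 := rowHt_succ M j c
    have d1 := ind_eq_one.2 h2.mem_upper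
    have d2 := ind_eq_zero.2 h2.notMem_lower
    refine ⟨fun t => F t + if t ≤ c then 1 else 0, fun r t => ?_, fun x y hxy => ?_, fun t => ?_,
      fun t => ?_, fun K k1 k2 k3 t => ?_⟩
    · rw [f1, h2.rowTail_eq]
      by_cases c1 : j = r <;> by_cases c2 : j + 1 = r <;> by_cases c3 : t ≤ c <;>
        simp [c1, c2, c3] <;> omega
    · have := f2 hxy
      simp only
      split_ifs <;> omega
    · have := f3 t
      simp only
      split_ifs <;> omega
    · have b1 := f4 t
      rw [h2.rowHt_eq] at b1
      simp only
      split_ifs at b1 ⊢ with c1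
      · have b2 := f4 (c + 1)
        rw [h2.rowHt_eq, if_neg (by omega)] at b2
        have b3 := f2 (show t ≤ c + 1 by omega)
        have := h2.1 t
        omega
      · omega
    -- This is a majorant of the heights after the first dropping: they fall by 2 up to c and were
    -- below the maximum beyond c. Adding back the dropped ball, the value at t ≤ c is at most the
    -- old maximum, hence at most K c ≤ K t.
    · have := f5 (fun t => if t ≤ c then rowHt M j c - 1 else min (K t) (rowHt M j c - 1))
        (fun x y hxy => by
          have := k1 hxy
          simp only
          split_ifs <;> omega)
        (fun t => by
          have := k2 t
          split_ifs <;> omega)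
        (fun t => by
          rw [h2.rowHt_eq]
          have := h2.1 t
          have := k3 t
          have := h2.2.1 t
          split_ifs <;> omega) t
      simp only at this ⊢
      have := k3 c
      have := @k1 t c
      split_ifs at * <;> omega

/-! ### Highest weight arrangements -/

/-- `[b + k - 1, …, b + 1, b]` -/
def dropList (b : ℕ) : ℕ → List ℕ
  | 0 => []
  | k + 1 => (b + k) :: dropList b k

/-- The concatenation of `dropList b 1, …, dropList b k`. -/
def collapseList (b : ℕ) : ℕ → List ℕ
  | 0 => []
  | k + 1 => collapseList b k ++ dropList b (k + 1)

theorem mem_dropList {b k j : ℕ} : j ∈ dropList b k ↔ b ≤ j ∧ j < b + k := by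
  induction k with
  | zero => simp [dropList]
  | succ k ih => simp only [dropList, List.mem_cons, ih]; omega

theorem mem_collapseList {b k j : ℕ} (h : j ∈ collapseList b k) : b ≤ j ∧ j < b + k := by
  induction k with
  | zero => simp [collapseList] at h
  | succ k ih =>
    simp only [collapseList, List.mem_append, mem_dropList] at h
    rcases h with h | h
    · have := ih h; omega
    · exact h

theorem exists_dSeq_dropFrom {L n k : ℕ} (hk : k + 1 ≤ L) {M : Arr} (hM : InGrid L n M) :
    ∃ as, DSeq (dropList 1 k) as M (dropFrom L n k M) := by
  induction k generalizing M with
  | zero => exact ⟨[], rfl⟩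
  | succ k ih =>
    obtain ⟨a, ha⟩ := exists_dStar_eDownStar (L := L) (n := n) (j := k + 1) (by omega) hk hM
    obtain ⟨as, h⟩ := ih (by omega) (ha.1.inGrid hM (by omega))
    refine ⟨a :: as, _, ?_, h⟩
    rw [add_comm 1 k]; exact ha

theorem exists_dSeq_collapseUpTo {L n k : ℕ} (hk : k + 1 ≤ L) {M : Arr} (hM : InGrid L n M) :
    ∃ as, DSeq (collapseList 1 k) as M (collapseUpTo L n k M) := by
  induction k with
  | zero => exact ⟨[], rfl⟩
  | succ k ih =>
    obtain ⟨as, h⟩ := ih (by omega)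
    obtain ⟨as', h'⟩ := exists_dSeq_dropFrom (L := L) (n := n) (k := k + 1) hk
      (h.inGrid hM fun j hj => (mem_collapseList hj).1)
    exact ⟨as ++ as', h.append h'⟩

theorem null_iff {j : ℕ} {M : Arr} : Null j M ↔ ∀ t, rowTail M (j + 1) t ≤ rowTail M j t := by
  simp [Null, rowHt]

/-- Row b + k consists of a part R dominated by the row below and an excess F, typically balls that
just arrived. Minimality in `DStar.exists_tail` gives that at most F is dropped further, so at least
R stays. Since R is then the content of the row before the arrivals, it still dominates what is left
in the row above. -/
theorem DSeq.null_dropList {L n b : ℕ} (hb : 1 ≤ b) (k : ℕ) (as : List ℕ) (M N : Arr)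
    (hM : InGrid L n M) (h : DSeq (dropList b k) as M N) (R F : ℕ → ℤ)
    (hRF : ∀ t, rowTail M (b + k) t = R t + F t) (hF : Antitone F) (hF0 : ∀ t, 0 ≤ F t)
    (hR : 1 ≤ k → ∀ t, R t ≤ rowTail M (b + k - 1) t)
    (hnull : ∀ j, b ≤ j → j + 1 < b + k → Null j M) :
    (∀ j, b ≤ j → j < b + k → Null j N) ∧ (∀ t, R t ≤ rowTail N (b + k) t) ∧
      ∀ r, b + k < r → ∀ t, rowTail N r t = rowTail M r t := by
  induction k generalizing as M R F with
  | zero =>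
    cases as with
    | nil =>
      obtain rfl : M = N := h
      exact ⟨by omega, fun t => by rw [hRF]; have := hF0 t; omega, fun _ _ _ => rfl⟩
    | cons => exact h.elim
  | succ k ih =>
    cases as with
    | nil => exact h.elim
    | cons a as =>
      obtain ⟨M', h1, h2⟩ := h
      obtain ⟨G, g1, g2, g3, g4, g5⟩ := h1.exists_tail hM (by omega)
      have hM' := h1.1.inGrid hM (by omega)
      have hR' := hR (by omega)
      rw [show b + (k + 1) - 1 = b + k by omega] at hR'
      rw [← add_assoc] at hRF
      have e1 : ∀ t, rowTail M' (b + k) t = rowTail M (b + k) t + G t := fun t => by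
        rw [g1]; simp
      have e2 : ∀ t, rowTail M' (b + k + 1) t = R t + F t - G t := fun t => by
        rw [g1, hRF]; simp
      have hGF : ∀ t, G t ≤ F t := g5 F hF hF0 fun t => by
        rw [rowHt, hRF]; have := hR' t; omega
      obtain ⟨i1, i2, i3⟩ := ih as M' hM' h2 (rowTail M (b + k)) G e1 g2 g3
        (fun hk t => by
          rw [g1, if_neg (by omega), if_neg (by omega)]
          have := null_iff.1 (hnull (b + k - 1) (by omega) (by omega)) t
          rw [show b + k - 1 + 1 = b + k by omega] at this
          omega)
        (fun j hj hj' => by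
          rw [null_iff]
          intro t
          rw [g1, g1, if_neg (by omega), if_neg (by omega), if_neg (by omega), if_neg (by omega)]
          have := null_iff.1 (hnull j hj (by omega)) t
          omega)
      refine ⟨fun j hj hj' => ?_, fun t => ?_, fun r hr t => ?_⟩
      · by_cases hjk : j < b + k
        · exact i1 j hj hjk
        · obtain rfl : j = b + k := by omega
          rw [null_iff]
          intro t
          rw [i3 _ (by omega), e2]
          have := i2 t
          have := g4 t
          rw [rowHt, hRF] at this
          omega
      · rw [← add_assoc, i3 _ (by omega), e2]
        have := hGF t
        omega
      · rw [i3 r (by omega), g1, if_neg (by omega), if_neg (by omega)]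
        omega

/-- The collapsing procedure makes the rows from `b` to `b + k` highest weight. -/
theorem DSeq.null_collapseList {L n b : ℕ} (hb : 1 ≤ b) (k : ℕ) (as : List ℕ) (M N : Arr)
    (hM : InGrid L n M) (h : DSeq (collapseList b k) as M N) :
    ∀ j, b ≤ j → j < b + k → Null j N := by
  induction k generalizing as N with
  | zero => omega
  | succ k ih =>
    obtain ⟨as₁, as₂, P, -, h1, h2⟩ := h.of_append
    have hP := ih as₁ P h1
    -- The newly included top row counts entirely as excess: R = 0 and F is its tail.
    exact (h2.null_dropList hb (k + 1) as₂ P N (h1.inGrid hM fun j hj => by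
      have := mem_collapseList hj; omega) 0 (rowTail P (b + (k + 1))) (by simp)
      (rowTail_antitone _ _) (fun t => rowTail_nonneg _ _ _) (fun _ t => rowTail_nonneg _ _ _)
      (fun j hj hj' => hP j hj (by omega))).1

/-- Let G ≤ F count the balls dropped into row m. Row m + 1 loses G, so row m + 2 exceeds it by at
most G, and G is the bound F for the next step. That step refills row m + 1 by at most G, so row m +
1 ends within its original tail, which row m plus G dominates. -/
theorem DSeq.null_range' {L n : ℕ} (k m : ℕ) (hm : 1 ≤ m) (as : List ℕ) (M N : Arr)
    (hM : InGrid L n M) (h : DSeq (List.range' m k) as M N) (F : ℕ → ℤ) (hF : Antitone F)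
    (hF0 : ∀ t, 0 ≤ F t)
    (hMF : 1 ≤ k → ∀ t, rowTail M (m + 1) t ≤ rowTail M m t + F t)
    (hnull : ∀ j, m < j → j < m + k → Null j M) :
    (∀ j, m ≤ j → j < m + k → Null j N) ∧ (∀ t, rowTail N m t ≤ rowTail M m t + F t) ∧
      ∀ r, r < m → ∀ t, rowTail N r t = rowTail M r t := by
  induction k generalizing m as M F with
  | zero =>
    cases as with
    | nil =>
      obtain rfl : M = N := h
      exact ⟨by omega, fun t => by have := hF0 t; omega, fun _ _ _ => rfl⟩
    | cons => exact h.elim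
  | succ k ih =>
    cases as with
    | nil => exact h.elim
    | cons a as =>
      obtain ⟨M', h1, h2⟩ := h
      obtain ⟨G, g1, g2, g3, g4, g5⟩ := h1.exists_tail hM (by omega)
      have hM' := h1.1.inGrid hM (by omega)
      have e1 : ∀ t, rowTail M' m t = rowTail M m t + G t := fun t => by
        rw [g1]; simp
      have e2 : ∀ t, rowTail M' (m + 1) t = rowTail M (m + 1) t - G t := fun t => by
        rw [g1]; simp
      have hGF : ∀ t, G t ≤ F t := g5 F hF hF0 fun t => by
        rw [rowHt]; have := hMF (by omega) t; omega
      obtain ⟨i1, i2, i3⟩ := ih (m + 1) (by omega) as M' hM' h2 G g2 g3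
        (fun hk t => by
          rw [e2, g1, if_neg (by omega), if_neg (by omega)]
          have := null_iff.1 (hnull (m + 1) (by omega) (by omega)) t
          omega)
        (fun j hj hj' => by
          rw [null_iff]
          intro t
          rw [g1, g1, if_neg (by omega), if_neg (by omega), if_neg (by omega), if_neg (by omega)]
          have := null_iff.1 (hnull j (by omega) (by omega)) t
          omega)
      refine ⟨fun j hj hj' => ?_, fun t => ?_, fun r hr t => ?_⟩
      · by_cases hjm : j = m
        · subst hjm
          rw [null_iff]
          intro t
          rw [i3 j (by omega), e1]
          have := i2 t
          rw [e2] at this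
          have := g4 t
          rw [rowHt] at this
          omega
        · exact i1 j (by omega) (by omega)
      · rw [i3 _ (by omega), e1]
        have := hGF t
        omega
      · rw [i3 r (by omega), g1, if_neg (by omega), if_neg (by omega)]
        omega

/-- If all row pairs but the lowest are highest weight, one ascending sweep is enough. -/
theorem DSeq.null_ascending {L n : ℕ} (k : ℕ) (as : List ℕ) (M N : Arr)
    (hM : InGrid L n M) (h : DSeq (List.range' 1 k) as M N)
    (hnull : ∀ j, 2 ≤ j → j ≤ k → Null j M) (j : ℕ) (hj : 1 ≤ j) (hjk : j ≤ k) : Null j N :=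
  (h.null_range' k 1 le_rfl as M N hM (rowTail M 2) (rowTail_antitone _ _)
    (fun _ => rowTail_nonneg _ _ _) (fun _ t => le_add_of_nonneg_left (rowTail_nonneg M 1 t))
    (fun j hj hj' => hnull j hj (by omega))).1 j hj (by omega)

/-! ### Arrangements that are highest weight for the column operators -/

/-- `M` is a source of the crystal graph. -/
def ColHighest (n : ℕ) (M : Arr) : Prop := ∀ i, 1 ≤ i → i + 1 ≤ n → ∀ u, colHt M i u ≤ 0

/-- All balls of `M` stay in their rows under row droppings. -/
def RowHighest (L : ℕ) (M : Arr) : Prop := ∀ j, 1 ≤ j → j + 1 ≤ L → Null j M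

section ColHighest

variable {L n : ℕ}

theorem DownN.colHighest_iff {j a : ℕ} {M N : Arr} (h : DownN j a M N) (hj : 1 ≤ j) :
    ColHighest n N ↔ ColHighest n M := by
  induction a generalizing M with
  | zero => rw [show M = N from h]
  | succ a ih =>
    obtain ⟨M', ⟨c, h1⟩, h2⟩ := h
    rw [ih h2]
    exact forall_congr' fun i => forall_congr' fun _ => forall_congr' fun _ => h1.colHt_le_iff hj 0

theorem DownN.colHead_top {j a : ℕ} {M N : Arr} (h : DownN j a M N) (hjL : j + 1 ≤ L) (c : ℕ) :
    colHead N c L = colHead M c L := by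
  induction a generalizing M with
  | zero => rw [show M = N from h]
  | succ a ih =>
    obtain ⟨M', ⟨c, h1⟩, h2⟩ := h
    rw [ih h2, h1.colHead_top hjL]

theorem DSeq.colHighest_iff {js as : List ℕ} {M N : Arr} (h : DSeq js as M N)
    (hj : ∀ j ∈ js, 1 ≤ j) : ColHighest n N ↔ ColHighest n M := by
  induction js generalizing as M with
  | nil =>
    cases as with
    | nil => rw [show M = N from h]
    | cons => exact h.elim
  | cons j js ih =>
    cases as with
    | nil => exact h.elim
    | cons a as =>
      obtain ⟨M', h1, h2⟩ := h
      rw [ih h2 fun j hj' => hj j (by simp [hj']), h1.1.colHighest_iff (hj j (by simp))]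

theorem DSeq.colHead_top {js as : List ℕ} {M N : Arr} (h : DSeq js as M N)
    (hj : ∀ j ∈ js, j + 1 ≤ L) (c : ℕ) : colHead N c L = colHead M c L := by
  induction js generalizing as M with
  | nil =>
    cases as with
    | nil => rw [show M = N from h]
    | cons => exact h.elim
  | cons j js ih =>
    cases as with
    | nil => exact h.elim
    | cons a as =>
      obtain ⟨M', h1, h2⟩ := h
      rw [ih h2 fun j hj' => hj j (by simp [hj']), h1.1.colHead_top (hj j (by simp))]

theorem UpSeq.colHighest_iff {ps : List (ℕ × ℕ)} {M N : Arr} (h : UpSeq ps M N)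
    (hj : ∀ p ∈ ps, 1 ≤ p.1) : ColHighest n N ↔ ColHighest n M := by
  induction ps generalizing M with
  | nil => rw [show M = N from h]
  | cons p ps ih =>
    obtain ⟨M', h1, h2⟩ := h
    rw [ih h2 fun j hj' => hj j (by simp [hj']), ← h1.colHighest_iff (hj p (by simp))]

theorem UpSeq.colHead_top {ps : List (ℕ × ℕ)} {M N : Arr} (h : UpSeq ps M N)
    (hj : ∀ p ∈ ps, p.1 + 1 ≤ L) (c : ℕ) : colHead N c L = colHead M c L := by
  induction ps generalizing M with
  | nil => rw [show M = N from h]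
  | cons p ps ih =>
    obtain ⟨M', h1, h2⟩ := h
    rw [ih h2 fun j hj' => hj j (by simp [hj']), ← h1.colHead_top (hj p (by simp))]

theorem rowTail_eq_zero_of_forall {M : Arr} {r t : ℕ} (h : ∀ c, t ≤ c → (r, c) ∉ M) :
    rowTail M r t = 0 := by
  unfold rowTail
  rw [Nat.cast_eq_zero, Finset.card_eq_zero, Finset.filter_eq_empty_iff]
  rintro ⟨x, y⟩ hb ⟨rfl, h2⟩
  exact h y h2 hb

/-! ### Highest weight in both directions -/

theorem colHead_le {N : Arr} (hN : InGrid L n N) (c r : ℕ) : colHead N c r ≤ r := by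
  induction r with
  | zero => rw [colHead_zero hN]; simp
  | succ r ih =>
    rw [colHead_succ]; have := ind_le_one N (r + 1) c; push_cast; omega

theorem colHead_eq_self {N : Arr} {c r : ℕ} (h0 : colHead N c 0 = 0)
    (h : ∀ s, 1 ≤ s → s ≤ r → (s, c) ∈ N) : colHead N c r = r := by
  induction r with
  | zero => simpa using h0
  | succ r ih =>
    rw [colHead_succ, ih fun s h1 h2 => h s h1 (by omega),
      ind_eq_one.2 (h (r + 1) (by omega) le_rfl)]
    push_cast; rfl

/-- The rows of an arrangement that is highest weight in both directions are nested initial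
segments. -/
theorem justified_of_highest {N : Arr} (hN : InGrid L n N) (hr : RowHighest L N)
    (hc : ColHighest n N) (r : ℕ) :
    (∀ c, 1 ≤ c → (r + 1, c + 1) ∈ N → (r + 1, c) ∈ N) ∧
      ∀ s c, 1 ≤ s → s ≤ r + 1 → (r + 1, c) ∈ N → (s, c) ∈ N := by
  -- If column c + 1 has a ball in row r + 1 and column c does not, then column c + 1 is full up to
  -- r + 1 while column c has at most r balls there, against `ColHighest`.
  have main : ∀ r, (∀ s c, 1 ≤ s → s ≤ r → (r + 1, c) ∈ N → (s, c) ∈ N) →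
      ∀ c, 1 ≤ c → (r + 1, c + 1) ∈ N → (r + 1, c) ∈ N := by
    intro r hs c hc1 hm
    by_contra hm'
    have h1 := hc c hc1 (hN.bounds hm).2.2 (r + 1)
    have h2 := colHead_eq_self (r := r) (colHead_zero hN (c + 1)) fun s h1 h2 => hs s _ h1 h2 hm
    have h3 := colHead_le hN c r
    rw [colHt, colHead_succ, colHead_succ, ind_eq_one.2 hm, ind_eq_zero.2 hm', h2] at h1
    omega
  induction r with
  | zero =>
    refine ⟨main 0 (by omega), fun s c h1 h2 h3 => ?_⟩
    obtain rfl : s = 0 + 1 := by omega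
    exact h3
  | succ r ih =>
    have hdown : ∀ c, (r + 1 + 1, c) ∈ N → (r + 1, c) ∈ N := by
      intro c hm
      by_contra hm'
      -- Row r + 1 is an initial segment, so a hole at c leaves it empty from c on and it cannot
      -- dominate the row above.
      have h1 : ∀ c', c ≤ c' → (r + 1, c') ∉ N := by
        intro c' hcc'
        induction c', hcc' using Nat.le_induction with
        | base => exact hm'
        | succ d hd ihd =>
          exact fun h => ihd (ih.1 d (by have := (hN.bounds hm).2.1; omega) h)
      have h2 := null_iff.1 (hr (r + 1) (by omega) (hN.bounds hm).1.2) c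
      rw [rowTail_eq_zero_of_forall h1, rowTail_succ, ind_eq_one.2 hm] at h2
      have := rowTail_nonneg N (r + 1 + 1) (c + 1)
      omega
    have hall : ∀ s c, 1 ≤ s → s ≤ r + 1 → (r + 1 + 1, c) ∈ N → (s, c) ∈ N :=
      fun s c h1 h2 h3 => ih.2 s c h1 h2 (hdown c h3)
    refine ⟨main (r + 1) hall, fun s c h1 h2 h3 => ?_⟩
    by_cases hs : s = r + 1 + 1
    · exact hs ▸ h3
    · exact hall s c h1 (by omega) h3

/-- Column c is a gapless stack starting at row 1, so its height is its number of balls. -/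
theorem mem_iff_of_highest {N : Arr} (hN : InGrid L n N) (hr : RowHighest L N)
    (hc : ColHighest n N) (r c : ℕ) :
    (r, c) ∈ N ↔ 1 ≤ r ∧ r ≤ L ∧ (r : ℤ) ≤ colHead N c L := by
  have hmono : ∀ a b, a ≤ b → colHead N c a ≤ colHead N c b := by
    intro a b hab
    exact monotone_nat_of_le_succ (f := colHead N c) (fun s => by
      rw [colHead_succ]; have := ind_nonneg N (s + 1) c; omega) hab
  constructor
  · intro h
    have hb := (hN.bounds h).1
    refine ⟨hb.1, hb.2, ?_⟩
    obtain ⟨r, rfl⟩ : ∃ k, r = k + 1 := ⟨r - 1, by omega⟩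
    rw [← colHead_eq_self (colHead_zero hN c) fun s h1 h2 =>
      (justified_of_highest hN hr hc r).2 s c h1 h2 h]
    exact hmono _ _ hb.2
  · rintro ⟨h1, h2, h3⟩
    by_contra h
    obtain ⟨r, rfl⟩ : ∃ k, r = k + 1 := ⟨r - 1, by omega⟩
    have key : ∀ s, r ≤ s → colHead N c s ≤ r := by
      intro s hs
      induction s, hs using Nat.le_induction with
      | base => exact colHead_le hN c r
      | succ s hs ih =>
        rw [colHead_succ, ind_eq_zero.2, add_zero]
        · exact ih
        · exact fun hm => h ((justified_of_highest hN hr hc s).2 (r + 1) c (by omega) (by omega) hm)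
    have := key L (by omega)
    push_cast at h3
    omega

theorem eq_of_highest {N N' : Arr} (hN : InGrid L n N) (hN' : InGrid L n N')
    (hr : RowHighest L N) (hr' : RowHighest L N') (hc : ColHighest n N) (hc' : ColHighest n N')
    (h : ∀ c, colHead N c L = colHead N' c L) : N = N' := by
  ext ⟨r, c⟩
  rw [mem_iff_of_highest hN hr hc, mem_iff_of_highest hN' hr' hc', h]

/-- A step along an edge of the crystal graph. -/
def FStep (L n : ℕ) (A B : Arr) : Prop := ∃ i, 1 ≤ i ∧ i + 1 ≤ n ∧ B = fRight L n i A

theorem rowTail_fRight {i : ℕ} {M : Arr} (hM : InGrid L n M) (hi : 1 ≤ i) (hin : i + 1 ≤ n)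
    (r : ℕ) : rowTail (fRight L n i M) r 0 = rowTail M r 0 := by
  rcases fRight_cases hM hi hin with ⟨-, h⟩ | ⟨s, h⟩
  · rw [h]
  · rw [h.rowTail_eq, if_neg (by omega), add_zero]

/-- Every arrangement is reached from a source of the crystal graph. -/
theorem exists_colHighest {M : Arr} (hM : InGrid L n M) :
    ∃ M₀, InGrid L n M₀ ∧ ColHighest n M₀ ∧ (∀ r, rowTail M₀ r 0 = rowTail M r 0) ∧
      Relation.ReflTransGen (FStep L n) M₀ M := by
  -- An inverse column operator moves a ball one column to the left, so it lowers the sum of the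
  -- columns.
  induction hk : ∑ b ∈ M, b.2 using Nat.strong_induction_on generalizing M with
  | _ k ih =>
  by_cases hc : ColHighest n M
  · exact ⟨M, hM, hc, fun _ => rfl, .refl⟩
  simp only [ColHighest, not_forall, not_le] at hc
  obtain ⟨i, hi, hin, u, hu⟩ := hc
  obtain ⟨s, h1, h2⟩ := exists_first_argmax (colHt M i) L _ fun t ht => colHt_of_le hM i ht
  have hs : s ≠ 0 := by
    rintro rfl
    have := h1 u
    rw [colHt_zero hM] at this
    omega
  obtain ⟨s, rfl⟩ : ∃ k, s = k + 1 := ⟨s - 1, by omega⟩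
  have a1 := colHt_succ M i s
  have a2 := h2 s (by omega)
  have := ind_le_one M (s + 1) (i + 1)
  have := ind_nonneg M (s + 1) i
  have m1 : (s + 1, i + 1) ∈ M := by rw [← ind_eq_one]; omega
  have m2 : (s + 1, i) ∉ M := by rw [← ind_eq_zero]; omega
  have d1 := ind_eq_one.2 m1
  have d2 := ind_eq_zero.2 m2
  have hb := hM.bounds m1
  set M' := moveBall M (s + 1, i + 1) (s + 1, i) with hM'
  have key : ∀ t, colHt M' i t = colHt M i t - if s < t then 2 else 0 := by
    intro t
    rw [colHt, colHt, colHead, colHead, hM', card_filter_moveBall m1 m2,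
      card_filter_moveBall m1 m2, colHead, colHead]
    by_cases h : s < t <;> simp [h]; ring
  have hR : RightAt i s M' M := by
    refine ⟨fun t => ?_, fun t ht => ?_, ?_⟩
    · rw [key, key]
      have := h1 t
      have := h2 t
      split_ifs <;> omega
    · rw [key, key]
      have := h1 t
      split_ifs <;> omega
    · rw [hM']
      ext ⟨x, y⟩
      simp only [mem_moveBall, Prod.mk.injEq, ne_eq]
      grind
  have hG : InGrid L n M' := by
    intro x hx
    rw [hM', mem_moveBall] at hx
    rcases hx with rfl | ⟨-, hx⟩
    · simp only [Finset.mem_product, Finset.mem_Icc]; omega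
    · exact hM hx
  have hsum : ∑ b ∈ M', b.2 < k := by
    rw [← hk, hM', moveBall, Finset.sum_insert (by simp [m2]),
      ← Finset.add_sum_erase M (fun b => b.2) m1]
    simp
  have hf := fRight_eq_of_rightAt hG hi hin hR
  obtain ⟨M₀, g1, g2, g3, g4⟩ := ih _ hsum hG rfl
  refine ⟨M₀, g1, g2, fun r => ?_, g4.tail ⟨i, hi, hin, hf.symm⟩⟩
  rw [g3, ← hf, rowTail_fRight hG hi hin]

end ColHighest

/-! ### Cyclic matching of two rows -/

/-- The number of elements of `S` from `t` on. -/
def tl (S : Finset ℕ) (t : ℕ) : ℤ := ((S.filter fun c => t ≤ c).card : ℤ)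

/-- The excess of `X` over `Q` from `t` on. -/
def ht (X Q : Finset ℕ) (t : ℕ) : ℤ := tl X t - tl Q t

/-- `c` is an element of the lower row `Q` that is not matched, cyclically, by the upper row `X`. -/
def IsFree (X Q : Finset ℕ) (c : ℕ) : Prop :=
  (∀ y, y ≤ c → ht X Q y < ht X Q (c + 1)) ∧ ∀ y, c < y → ht X Q y + ht X Q 0 < ht X Q (c + 1)

open Classical in
/-- The elements of the lower row `Q` that are matched, cyclically, by the upper row `X`. -/
noncomputable def matched (X Q : Finset ℕ) : Finset ℕ := Q.filter fun c => ¬ IsFree X Q c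

theorem mem_rowSet {M : Arr} {r c : ℕ} : c ∈ rowSet M r ↔ (r, c) ∈ M := by
  simp [rowSet]

theorem tl_rowSet (M : Arr) (r t : ℕ) : tl (rowSet M r) t = rowTail M r t := by
  unfold tl rowTail
  congr 1
  refine Finset.card_bij (fun c _ => (r, c)) ?_ ?_ ?_
  · intro c hc
    simp only [Finset.mem_filter, mem_rowSet] at hc ⊢
    exact ⟨hc.1, trivial, hc.2⟩
  · intro a _ b _ h
    simpa using h
  · rintro ⟨x, y⟩ h
    simp only [Finset.mem_filter] at h
    obtain ⟨h1, rfl, h2⟩ := h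
    exact ⟨y, by simpa [mem_rowSet] using ⟨h1, h2⟩, rfl⟩

theorem ht_rowSet (M : Arr) (j t : ℕ) : ht (rowSet M (j + 1)) (rowSet M j) t = rowHt M j t := by
  rw [ht, tl_rowSet, tl_rowSet, rowHt]

theorem tl_zero (S : Finset ℕ) : tl S 0 = S.card := by simp [tl]

theorem tl_nonneg (S : Finset ℕ) (t : ℕ) : 0 ≤ tl S t := Int.natCast_nonneg _

theorem tl_mono {S T : Finset ℕ} (h : S ⊆ T) (t : ℕ) : tl S t ≤ tl T t := by
  unfold tl
  exact_mod_cast Finset.card_le_card (Finset.filter_subset_filter _ h)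

theorem tl_succ (S : Finset ℕ) (t : ℕ) : tl S t = tl S (t + 1) + if t ∈ S then 1 else 0 := by
  have h := rowTail_succ (S.image fun c => (1, c)) 1 t
  have e : rowSet (S.image fun c => (1, c)) 1 = S := by
    ext c; simp [mem_rowSet]
  rw [← tl_rowSet, ← tl_rowSet, e] at h
  rw [h, ind]
  simp

theorem tl_antitone (S : Finset ℕ) : Antitone (tl S) :=
  antitone_nat_of_succ_le fun t => by rw [tl_succ S t]; split_ifs <;> omega

theorem tl_insert {S : Finset ℕ} {x : ℕ} (hx : x ∉ S) (t : ℕ) :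
    tl (insert x S) t = tl S t + if t ≤ x then 1 else 0 := by
  unfold tl
  rw [Finset.filter_insert]
  split_ifs
  · rw [Finset.card_insert_of_notMem (by simp [hx])]; push_cast; rfl
  · simp

theorem tl_eq_zero {S : Finset ℕ} {t : ℕ} (h : ∀ c ∈ S, c < t) : tl S t = 0 := by
  unfold tl
  rw [Nat.cast_eq_zero, Finset.card_eq_zero, Finset.filter_eq_empty_iff]
  intro c hc
  have := h c hc
  omega

theorem exists_ht_eq_zero (X Q : Finset ℕ) : ∃ N, ∀ t, N ≤ t → ht X Q t = 0 := by
  refine ⟨X.sup id + Q.sup id + 1, fun t ht' => ?_⟩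
  rw [ht, tl_eq_zero, tl_eq_zero, sub_zero]
  · intro c hc
    have : c ≤ Q.sup id := Finset.le_sup (f := id) hc
    omega
  · intro c hc
    have : c ≤ X.sup id := Finset.le_sup (f := id) hc
    omega

theorem IsFree.mem {X Q : Finset ℕ} {c : ℕ} (h : IsFree X Q c) : c ∈ Q := by
  have h1 := h.1 c le_rfl
  rw [ht, ht, tl_succ X c, tl_succ Q c] at h1
  by_contra hc
  simp only [hc, if_false] at h1
  split_ifs at h1 <;> omega

theorem mem_matched {X Q : Finset ℕ} {c : ℕ} : c ∈ matched X Q ↔ c ∈ Q ∧ ¬ IsFree X Q c := by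
  simp [matched]

theorem matched_subset (X Q : Finset ℕ) : matched X Q ⊆ Q := fun _ h => (mem_matched.1 h).1

/-- A lower ball c is unmatched when every cyclic interval ending at c has more lower than upper
balls. An interval starting at y ≤ c has excess ht y - ht (c + 1); one starting at y > c wraps
around and picks up the total ht 0. A first maximum of the height satisfies both conditions when the
total is negative. -/
theorem exists_isFree {X Q : Finset ℕ} (h : ht X Q 0 < 0) : ∃ c, IsFree X Q c := by
  obtain ⟨N, hN⟩ := exists_ht_eq_zero X Q
  obtain ⟨m, h1, h2⟩ := exists_first_argmax (ht X Q) N 0 hN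
  have h3 := h1 N
  rw [hN N le_rfl] at h3
  have hm : m ≠ 0 := by rintro rfl; omega
  obtain ⟨c, rfl⟩ : ∃ k, m = k + 1 := ⟨m - 1, by omega⟩
  exact ⟨c, fun y hy => h2 y (by omega), fun y _ => by have := h1 y; omega⟩

/-- `p` is the first element satisfying `P`, cyclically from `x` on. -/
def CyclicFirst (P : ℕ → Prop) (x p : ℕ) : Prop :=
  P p ∧ ((x ≤ p ∧ ∀ c, P c → x ≤ c → p ≤ c) ∨ (p < x ∧ ∀ c, P c → c < x ∧ p ≤ c))

theorem ht_insert {X Q : Finset ℕ} {x : ℕ} (hx : x ∉ X) (t : ℕ) :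
    ht (insert x X) Q t = ht X Q t + if t ≤ x then 1 else 0 := by
  rw [ht, ht, tl_insert hx]; ring

/-- Matching one more ball uses up the first free element, cyclically. -/
theorem isFree_insert {X Q : Finset ℕ} {x p : ℕ} (hx : x ∉ X) (h0 : ht X Q 0 < 0)
    (hp : CyclicFirst (IsFree X Q) x p) (c : ℕ) :
    IsFree (insert x X) Q c ↔ IsFree X Q c ∧ c ≠ p := by
  have key := fun t => ht_insert (Q := Q) hx t
  have key0 := key 0
  rw [if_pos (Nat.zero_le x)] at key0
  obtain ⟨hpf, hp⟩ := hp
  constructor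
  · intro hc
    refine ⟨⟨fun y hy => ?_, fun y hy => ?_⟩, ?_⟩
    · have := hc.1 y hy
      rw [key, key] at this
      split_ifs at this <;> omega
    · have := hc.2 y hy
      rw [key0, key, key] at this
      split_ifs at this <;> omega
    · rintro rfl
      obtain ⟨g1, g2⟩ := hc
      simp only [key] at g1 g2
      have a1 := hpf.1 c le_rfl
      have a2 : ht X Q (c + 1) ≤ ht X Q c + 1 := by
        rw [ht, ht, tl_succ X c, tl_succ Q c]
        split_ifs <;> omega
      -- Were c = p still free, take the first position t, cyclically after x, where the height
      -- reaches ht (c + 1) - 1, with ht 0 added before the wrap. Then t - 1 is free and precedes p,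
      -- contradicting the choice of p. The cases distinguish p ≥ x, a wrapping p with t beyond x,
      -- and a wrapping p with t after the wrap.
      rcases hp with ⟨hxp, hfirst⟩ | ⟨hxp, hfirst⟩
      · have hex : ∃ t, t ≤ c ∧ ht X Q (c + 1) - 1 ≤ ht X Q t := ⟨c, le_rfl, by omega⟩
        classical
        obtain ⟨ht1, ht2⟩ := Nat.find_spec hex
        have hmin := fun t => Nat.find_min hex (m := t)
        generalize Nat.find hex = t at ht1 ht2 hmin
        have hxt : x < t := by
          by_contra hle
          have := g1 t ht1
          rw [if_pos (by omega), if_neg (by omega)] at this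
          omega
        have := hfirst (t - 1) ⟨fun y hy => ?_, fun y hy => ?_⟩ (by omega)
        · omega
        · rw [show t - 1 + 1 = t by omega]
          have := hmin y (by omega)
          by_contra hcon
          exact this ⟨by omega, by omega⟩
        · rw [show t - 1 + 1 = t by omega]
          rcases le_or_gt y c with hyc | hyc
          · have := hpf.1 y hyc; omega
          · have := g2 y hyc
            split_ifs at this <;> omega
      · by_cases hex : ∃ y, x < y ∧ ht X Q (c + 1) - 1 ≤ ht X Q y + ht X Q 0
        · classical
          obtain ⟨ht1, ht2⟩ := Nat.find_spec hex
          have hmin := fun t => Nat.find_min hex (m := t)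
          generalize Nat.find hex = t at ht1 ht2 hmin
          have := (hfirst (t - 1) ⟨fun y hy => ?_, fun y hy => ?_⟩).1
          · omega
          · rw [show t - 1 + 1 = t by omega]
            rcases le_or_gt y c with hyc | hyc
            · have := hpf.1 y hyc; omega
            · rcases le_or_gt y x with hyx | hyx
              · have := g2 y hyc
                rw [if_pos hyx, if_pos (by omega)] at this
                omega
              · have := hmin y (by omega)
                by_contra hcon
                exact this ⟨hyx, by omega⟩
          · rw [show t - 1 + 1 = t by omega]
            have := hpf.2 y (by omega)
            omega
        · have hex' : ∃ t, t ≤ c ∧ ht X Q (c + 1) - 1 ≤ ht X Q t := ⟨c, le_rfl, by omega⟩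
          classical
          obtain ⟨ht1, ht2⟩ := Nat.find_spec hex'
          have hmin := fun t => Nat.find_min hex' (m := t)
          generalize Nat.find hex' = t at ht1 ht2 hmin
          have ht0 : t ≠ 0 := by
            rintro rfl
            obtain ⟨N, hN⟩ := exists_ht_eq_zero X Q
            have h3 := hN (N + x + 1) (by omega)
            exact hex ⟨N + x + 1, by omega, by omega⟩
          have := (hfirst (t - 1) ⟨fun y hy => ?_, fun y hy => ?_⟩).2
          · omega
          · rw [show t - 1 + 1 = t by omega]
            have := hmin y (by omega)
            by_contra hcon
            exact this ⟨by omega, by omega⟩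
          · rw [show t - 1 + 1 = t by omega]
            rcases le_or_gt y c with hyc | hyc
            · have := hpf.1 y hyc; omega
            · rcases le_or_gt y x with hyx | hyx
              · have := g2 y hyc
                rw [if_pos hyx, if_pos (by omega)] at this
                omega
              · by_contra hcon
                exact hex ⟨y, hyx, by omega⟩
  -- The inserted ball raises heights by one up to x. Whenever this affects a comparison for c, the
  -- free element p lies in between, and its strict inequality supplies the extra unit.
  · rintro ⟨hc, hcp⟩
    have b1 := hc.1
    have b2 := hc.2
    refine ⟨fun y hy => ?_, fun y hy => ?_⟩
    · rw [key, key]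
      have := b1 y hy
      rcases hp with ⟨hxp, hfirst⟩ | ⟨hxp, hfirst⟩
      · rcases le_or_gt x c with hxc | hxc
        · have := hfirst c hc hxc
          have := b1 (p + 1) (by omega)
          have := hpf.1 y
          split_ifs <;> omega
        · split_ifs <;> omega
      · have := (hfirst c hc)
        split_ifs <;> omega
    · rw [key0, key, key]
      have := b2 y hy
      rcases hp with ⟨hxp, hfirst⟩ | ⟨hxp, hfirst⟩
      · rcases le_or_gt x c with hxc | hxc
        · have := hfirst c hc hxc
          have := b1 (p + 1) (by omega)
          have := hpf.2 y (by omega)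
          split_ifs <;> omega
        · have := b2 (p + 1) (by omega)
          have := hpf.1 y
          split_ifs <;> omega
      · have := (hfirst c hc)
        have := b1 (p + 1) (by omega)
        have := hpf.2 y (by omega)
        split_ifs <;> omega

theorem isFree_empty {Q : Finset ℕ} {c : ℕ} : IsFree ∅ Q c ↔ c ∈ Q := by
  refine ⟨IsFree.mem, fun hc => ?_⟩
  have h0 : ∀ t, ht ∅ Q t = - tl Q t := fun t => by simp [ht, tl]
  have h1 := tl_succ Q c
  rw [if_pos hc] at h1
  refine ⟨fun y hy => ?_, fun y hy => ?_⟩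
  · rw [h0, h0]
    have := tl_antitone Q hy
    omega
  · rw [h0, h0, h0]
    have := tl_antitone Q (Nat.zero_le c)
    have := tl_nonneg Q y
    omega

/-! ### The Ferrari-Martin labelling as iterated matching -/

theorem find?_cyclicFrom {n x : ℕ} (hx : 1 ≤ x) (P : ℕ → Prop) [DecidablePred P]
    (hP : ∀ c, P c → 1 ≤ c ∧ c ≤ n) (hex : ∃ c, P c) :
    ∃ p, (cyclicFrom n x).find? (fun c => decide (P c)) = some p ∧ CyclicFirst P x p := by
  rw [cyclicFrom, List.find?_append]
  cases h1 : (List.range' x (n + 1 - x)).find? (fun c => decide (P c)) with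
  | some p =>
    refine ⟨p, rfl, ?_⟩
    rw [List.find?_range'_eq_some] at h1
    obtain ⟨h1, h2, h3⟩ := h1
    rw [List.mem_range'_1] at h2
    refine ⟨by simpa using h1, Or.inl ⟨h2.1, fun c hc hxc => ?_⟩⟩
    by_contra hcp
    have := h3 c hxc (by omega)
    simp [hc] at this
  | none =>
    rw [List.find?_range'_eq_none] at h1
    have h1' : ∀ c, P c → c < x := by
      intro c hc
      by_contra hcx
      have := h1 c (by omega) (by have := hP c hc; omega)
      simp [hc] at this
    rw [Option.none_or]
    cases h2 : (List.range' 1 (x - 1)).find? (fun c => decide (P c)) with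
    | none =>
      rw [List.find?_range'_eq_none] at h2
      obtain ⟨c, hc⟩ := hex
      have := h2 c (hP c hc).1 (by have := h1' c hc; omega)
      simp [hc] at this
    | some p =>
      rw [List.find?_range'_eq_some] at h2
      obtain ⟨h2, h3, h4⟩ := h2
      rw [List.mem_range'_1] at h3
      refine ⟨p, rfl, by simpa using h2, Or.inr ⟨by omega, fun c hc => ⟨h1' c hc, ?_⟩⟩⟩
      by_contra hcp
      have := h4 c (hP c hc).1 (by omega)
      simp [hc] at this

/-- Labels are processed in decreasing order, so for k at most the current label all processed balls
lie in the threshold set, and the new pairing is one application of `isFree_insert`. For larger k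
the new label is irrelevant. The cardinality bound guarantees that every ball finds a partner. -/
theorem le_foldl_pairBall {n : ℕ} {B : Finset ℕ} (hB : ∀ c ∈ B, 1 ≤ c ∧ c ≤ n) (up : ℕ → ℕ)
    (l : List ℕ) (hl : l.Pairwise fun a b => up b ≤ up a ∧ a ≠ b)
    (hl1 : ∀ c ∈ l, 1 ≤ c ∧ 1 ≤ up c) (hcard : l.length ≤ B.card) {k : ℕ} (hk : 1 ≤ k) (c : ℕ) :
    k ≤ l.foldl (fun low c => pairBall n B (up c) low c) (fun _ => 0) c ↔
      c ∈ matched (l.toFinset.filter fun c => k ≤ up c) B := by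
  induction l using List.reverseRecOn generalizing k c with
  | nil =>
    simp [mem_matched, isFree_empty]
    omega
  | append_singleton l x ih =>
    rw [List.pairwise_append] at hl
    obtain ⟨hl2, -, hl3⟩ := hl
    have hx : x ∉ l := fun h => (hl3 x h x (by simp)).2 rfl
    have hup : ∀ a ∈ l, up x ≤ up a := fun a ha => (hl3 a ha x (by simp)).1
    have hx1 := hl1 x (by simp)
    rw [List.length_append, List.length_singleton] at hcard
    replace ih := fun k hk c => @ih hl2 (fun c hc => hl1 c (by simp [hc])) (by omega) k hk c
    rw [List.foldl_append, List.foldl_cons, List.foldl_nil]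
    generalize hlow : l.foldl (fun low c => pairBall n B (up c) low c) (fun _ => 0) = low at ih ⊢
    have hall : ∀ k, k ≤ up x → (l.toFinset.filter fun c => k ≤ up c) = l.toFinset := by
      intro k hk
      rw [Finset.filter_eq_self]
      intro a ha
      exact hk.trans (hup a (by simpa using ha))
    have hfree : ∀ a, IsFree l.toFinset B a ↔ a ∈ B ∧ low a = 0 := by
      intro a
      have := ih 1 le_rfl a
      rw [hall 1 hx1.2, mem_matched] at this
      constructor
      · intro h
        refine ⟨h.mem, ?_⟩
        by_contra h0
        exact (this.1 (by omega)).2 h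
      · rintro ⟨h1, h2⟩
        by_contra h3
        have := this.2 ⟨h1, h3⟩
        omega
    have hlt : ht l.toFinset B 0 < 0 := by
      rw [ht, tl_zero, tl_zero]
      have := List.toFinset_card_le l
      omega
    obtain ⟨p, hp, hcf⟩ := find?_cyclicFrom (n := n) hx1.1 (fun a => a ∈ B ∧ low a = 0)
      (fun c hc => hB c hc.1) (by
        obtain ⟨a, ha⟩ := exists_isFree hlt
        exact ⟨a, (hfree a).1 ha⟩)
    have hp0 := hcf.1
    have hpb : pairBall n B (up x) low x = Function.update low p (up x) := by
      rw [pairBall, hp]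
    have hcf' : CyclicFirst (IsFree l.toFinset B) x p := by
      have : IsFree l.toFinset B = fun a => a ∈ B ∧ low a = 0 := funext fun a => propext (hfree a)
      rw [this]; exact hcf
    have hins := isFree_insert (Q := B) (by simpa using hx) hlt hcf'
    rw [hpb]
    rcases le_or_gt k (up x) with hkx | hkx
    · have e : ((l ++ [x]).toFinset.filter fun c => k ≤ up c) = insert x l.toFinset := by
        rw [List.toFinset_append, Finset.filter_union, hall k hkx]
        ext a; simp; grind
      rw [e, mem_matched, hins]
      have h1 := ih k hk c
      rw [hall k hkx, mem_matched] at h1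
      by_cases hcp : c = p
      · subst hcp
        rw [Function.update_self]
        simp [hkx, hp0.1]
      · rw [Function.update_of_ne hcp, h1]
        simp [hcp]
    · have e : ((l ++ [x]).toFinset.filter fun c => k ≤ up c) =
          l.toFinset.filter fun c => k ≤ up c := by
        rw [List.toFinset_append, Finset.filter_union]
        ext a; simp; grind
      rw [e, ← ih k hk c]
      by_cases hcp : c = p
      · subst hcp
        rw [Function.update_self, hp0.2]
        omega
      · rw [Function.update_of_ne hcp]

theorem mem_pairingOrder {L n c : ℕ} {lab : ℕ → ℕ} : c ∈ pairingOrder L n lab ↔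
    (1 ≤ c ∧ c ≤ n) ∧ 1 ≤ lab c ∧ lab c ≤ L := by
  simp only [pairingOrder, List.mem_flatMap, List.mem_reverse, List.mem_range'_1, List.mem_filter,
    decide_eq_true_eq]
  constructor
  · rintro ⟨k, h1, h2, rfl⟩
    omega
  · rintro ⟨h1, h2⟩
    exact ⟨lab c, by omega, by omega, rfl⟩

theorem pairwise_pairingOrder (L n : ℕ) (lab : ℕ → ℕ) :
    (pairingOrder L n lab).Pairwise fun a b => lab b ≤ lab a ∧ a ≠ b := by
  rw [pairingOrder, List.pairwise_flatMap]
  constructor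
  · intro k _
    have h : ((List.range' 1 n).filter fun c => lab c = k).Nodup := List.Nodup.filter _ List.nodup_range'
    refine List.Pairwise.imp_of_mem ?_ h
    intro a b ha hb hab
    simp only [List.mem_filter, decide_eq_true_eq] at ha hb
    exact ⟨by omega, hab⟩
  · rw [List.pairwise_reverse]
    refine List.Pairwise.imp ?_ (List.pairwise_lt_range' (s := 1) (n := L))
    intro a b hab x hx y hy
    simp only [List.mem_filter, decide_eq_true_eq] at hx hy
    refine ⟨by omega, ?_⟩
    rintro rfl
    omega

/-- The columns of labels at least `k`. -/
def geSet (n : ℕ) (lab : ℕ → ℕ) (k : ℕ) : Finset ℕ := (Finset.Icc 1 n).filter fun c => k ≤ lab c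

theorem mem_geSet {n : ℕ} {lab : ℕ → ℕ} {k c : ℕ} :
    c ∈ geSet n lab k ↔ (1 ≤ c ∧ c ≤ n) ∧ k ≤ lab c := by
  simp [geSet]

/-- `lab` is a labelling of the balls `B` by labels between `r` and `L`. -/
def IsLabelling (L r : ℕ) (B : Finset ℕ) (lab : ℕ → ℕ) : Prop :=
  ∀ c, (c ∈ B → r ≤ lab c ∧ lab c ≤ L) ∧ (c ∉ B → lab c = 0)

theorem labelStep_spec {L n r : ℕ} {B A : Finset ℕ} {up : ℕ → ℕ} (hr : 1 ≤ r) (hrL : r ≤ L)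
    (hB : ∀ c ∈ B, 1 ≤ c ∧ c ≤ n) (hA : ∀ c ∈ A, 1 ≤ c ∧ c ≤ n) (hup : IsLabelling L (r + 1) A up)
    (hcard : A.card ≤ B.card) :
    IsLabelling L r B (labelStep L n r B up) ∧
      ∀ k, r < k → geSet n (labelStep L n r B up) k = matched (geSet n up k) B := by
  set low := (pairingOrder L n up).foldl (fun low c => pairBall n B (up c) low c) (fun _ => 0)
    with hlow
  have hstep : ∀ c, labelStep L n r B up c = if c ∈ B ∧ low c = 0 then r else low c := fun c => rfl
  have hmem : ∀ c, c ∈ pairingOrder L n up ↔ c ∈ A := by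
    intro c
    rw [mem_pairingOrder]
    have := hup c
    have := hA c
    by_cases hc : c ∈ A
    · simp only [hc, true_imp_iff, iff_true] at *
      omega
    · simp only [hc, not_false_eq_true, true_imp_iff, iff_false] at *
      omega
  have htf : (pairingOrder L n up).toFinset = A := by ext c; simp [hmem]
  have hnd : (pairingOrder L n up).Nodup := (pairwise_pairingOrder L n up).imp fun h => h.2
  have hspec : ∀ k, 1 ≤ k → ∀ c, k ≤ low c ↔ c ∈ matched (A.filter fun c => k ≤ up c) B := by
    intro k hk c
    rw [← htf]
    refine le_foldl_pairBall hB up _ (pairwise_pairingOrder L n up) (fun c hc => ?_) ?_ hk c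
    · rw [mem_pairingOrder] at hc
      omega
    · rw [← List.toFinset_card_of_nodup hnd, htf]; exact hcard
  have hge : ∀ k, 1 ≤ k → (A.filter fun c => k ≤ up c) = geSet n up k := by
    intro k hk
    ext c
    rw [Finset.mem_filter, mem_geSet]
    constructor
    · rintro ⟨h1, h2⟩; exact ⟨hA c h1, h2⟩
    · rintro ⟨h1, h2⟩
      refine ⟨?_, h2⟩
      by_contra hc
      have := (hup c).2 hc
      omega
  have hlowB : ∀ c, low c ≠ 0 → c ∈ B ∧ r + 1 ≤ low c := by
    intro c hc
    have h1 := (hspec 1 le_rfl c).1 (by omega)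
    refine ⟨matched_subset _ _ h1, ?_⟩
    rw [hspec (r + 1) (by omega) c]
    convert h1 using 2
    ext a
    simp only [Finset.mem_filter]
    have := (hup a).1
    constructor
    · rintro ⟨h2, h3⟩; exact ⟨h2, by omega⟩
    · rintro ⟨h2, h3⟩; exact ⟨h2, (this h2).1⟩
  refine ⟨fun c => ⟨fun hc => ?_, fun hc => ?_⟩, fun k hk => ?_⟩
  · rw [hstep]
    split_ifs with h
    · omega
    · have h1 := hlowB c (fun h0 => h ⟨hc, h0⟩)
      refine ⟨by omega, ?_⟩
      by_contra h2
      -- No upper label exceeds L, so at threshold L + 1 the empty set is matched and no lower ball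
      -- can qualify.
      have h3 := (hspec (L + 1) (by omega) c).1 (by omega)
      rw [show (A.filter fun c => L + 1 ≤ up c) = ∅ by
        rw [Finset.filter_eq_empty_iff]; intro a ha; have := (hup a).1 ha; omega] at h3
      rw [mem_matched, isFree_empty] at h3
      exact h3.2 h3.1
  · rw [hstep, if_neg (fun h => hc h.1)]
    by_contra h0
    exact hc (hlowB c h0).1
  · ext c
    rw [mem_geSet, ← hge k (by omega), ← hspec k (by omega), hstep]
    constructor
    · rintro ⟨h1, h2⟩
      split_ifs at h2 <;> omega
    · intro h1
      have h2 := hlowB c (by omega)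
      refine ⟨hB c h2.1, ?_⟩
      rw [if_neg (by omega)]
      exact h1

theorem label_eq_labelStep {L n r : ℕ} (hrL : r ≤ L) (M : Arr) :
    label L n M r = labelStep L n r (rowSet M r) (label L n M (r + 1)) := by
  funext c
  rw [label, show L + 1 - r = (L - r) + 1 by omega, fmRow, show L - (L - r) = r by omega]
  congr 1
  funext c
  rw [label, show L + 1 - (r + 1) = L - r by omega]

theorem bounds_of_mem_rowSet {L n : ℕ} {M : Arr} (hM : InGrid L n M) (r : ℕ) :
    ∀ c ∈ rowSet M r, 1 ≤ c ∧ c ≤ n := fun _ hc => (hM.bounds (mem_rowSet.1 hc)).2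

theorem rowSet_eq_empty {L n : ℕ} {M : Arr} (hM : InGrid L n M) {r : ℕ} (hr : L < r) :
    rowSet M r = ∅ := by
  rw [Finset.eq_empty_iff_forall_notMem]
  intro c hc
  have := hM.bounds (mem_rowSet.1 hc)
  omega

theorem label_spec {L n : ℕ} {M : Arr} (hM : InGrid L n M)
    (hcard : ∀ r, 1 ≤ r → r + 1 ≤ L → (rowSet M (r + 1)).card ≤ (rowSet M r).card) (d : ℕ) :
    ∀ r, 1 ≤ r → r + d = L → IsLabelling L r (rowSet M r) (label L n M r) ∧
      ∀ k, r < k → geSet n (label L n M r) k =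
        matched (geSet n (label L n M (r + 1)) k) (rowSet M r) := by
  induction d with
  | zero =>
    intro r hr hd
    obtain rfl : r = L := hd
    have h0 : label r n M (r + 1) = fun _ => 0 := by
      funext c; rw [label, Nat.sub_self, fmRow]
    rw [label_eq_labelStep le_rfl]
    refine labelStep_spec (A := ∅) hr le_rfl (bounds_of_mem_rowSet hM r) (by simp) ?_ (by simp)
    intro c
    simp [h0]
  | succ d ih =>
    intro r hr hd
    rw [label_eq_labelStep (by omega : r ≤ L)]
    exact labelStep_spec hr (by omega) (bounds_of_mem_rowSet hM r) (bounds_of_mem_rowSet hM (r + 1))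
      (ih (r + 1) (by omega) (by omega)).1 (hcard r hr (by omega))

/-- The set `Z ⊆ B_r`, matched successively through the rows `r - 1, …, 1`. -/
noncomputable def push (M : Arr) : ℕ → Finset ℕ → Finset ℕ
  | 0, Z => Z
  | r + 1, Z => push M r (matched Z (rowSet M (r + 1)))

/-- All labels in row k + 1 are at least k + 1, so the threshold set starts as the whole row and is
then matched down row by row. -/
theorem geSet_label_one {L n : ℕ} {M : Arr} (hM : InGrid L n M)
    (hcard : ∀ r, 1 ≤ r → r + 1 ≤ L → (rowSet M (r + 1)).card ≤ (rowSet M r).card) {k : ℕ}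
    (hkL : k + 1 ≤ L) :
    geSet n (label L n M 1) (k + 1) = push M k (rowSet M (k + 1)) := by
  have key : ∀ r, r ≤ k → geSet n (label L n M 1) (k + 1) =
      push M r (geSet n (label L n M (r + 1)) (k + 1)) := by
    intro r hr
    induction r with
    | zero => rfl
    | succ r ih =>
      rw [ih (by omega), push, (label_spec hM hcard (L - (r + 1)) (r + 1) (by omega)
        (by omega)).2 (k + 1) (by omega)]
  rw [key k le_rfl]
  congr 1
  have h := (label_spec hM hcard (L - (k + 1)) (k + 1) (by omega) (by omega)).1
  ext c
  rw [mem_geSet]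
  constructor
  · rintro ⟨-, h2⟩
    by_contra hc
    have := (h c).2 hc
    omega
  · intro hc
    exact ⟨bounds_of_mem_rowSet hM _ c hc, ((h c).1 hc).1⟩

/-! ### Inverse row droppings and matching -/

theorem DownN.snoc {j a : ℕ} {M N P : Arr} (h : DownN j a M N) (h' : Down j N P) :
    DownN j (a + 1) M P := by
  induction a generalizing M with
  | zero => obtain rfl : M = N := h; exact ⟨P, h', rfl⟩
  | succ a ih =>
    obtain ⟨M', h1, h2⟩ := h
    exact ⟨M', h1, ih h2⟩

theorem DownN.rowTail_zero {j a : ℕ} {M N : Arr} (h : DownN j a M N) (r : ℕ) :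
    rowTail N r 0 = rowTail M r 0 + (if j = r then (a : ℤ) else 0) -
      (if j + 1 = r then (a : ℤ) else 0) := by
  induction a generalizing M with
  | zero => obtain rfl : M = N := h; simp
  | succ a ih =>
    obtain ⟨M', ⟨c, h1⟩, h2⟩ := h
    rw [ih h2, h1.rowTail_eq]
    simp only [Nat.zero_le, and_true]
    push_cast
    split_ifs <;> omega

theorem DownAt.rowSet_of_ne {j c r : ℕ} {M N : Arr} (h : DownAt j c M N) (h1 : r ≠ j)
    (h2 : r ≠ j + 1) : rowSet N r = rowSet M r := by
  ext x
  rw [mem_rowSet, mem_rowSet, h.2.2, mem_moveBall]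
  simp [h1, h2]

theorem DownN.rowSet_of_ne {j a r : ℕ} {M N : Arr} (h : DownN j a M N) (h1 : r ≠ j)
    (h2 : r ≠ j + 1) : rowSet N r = rowSet M r := by
  induction a generalizing M with
  | zero => rw [show M = N from h]
  | succ a ih =>
    obtain ⟨M', ⟨c, h3⟩, h4⟩ := h
    rw [ih h4, h3.rowSet_of_ne h1 h2]

theorem DSeq.rowSet_of_lt {r : ℕ} {js as : List ℕ} {M N : Arr} (h : DSeq js as M N)
    (hj : ∀ j ∈ js, r < j) : rowSet N r = rowSet M r := by
  induction js generalizing as M with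
  | nil =>
    cases as with
    | nil => rw [show M = N from h]
    | cons => exact h.elim
  | cons j js ih =>
    cases as with
    | nil => exact h.elim
    | cons a as =>
      obtain ⟨M', h1, h2⟩ := h
      have := hj j (by simp)
      rw [ih h2 fun j hj' => hj j (by simp [hj']), h1.1.rowSet_of_ne (by omega) (by omega)]

/-- The `d` rightmost unmatched elements of the lower row can be raised. -/
theorem exists_downN_raise {L n j : ℕ} (d : ℕ) {M : Arr} (hM : InGrid L n M) (hjL : j + 1 ≤ L)
    (hd : ∃ t, rowHt M j 0 + d ≤ rowHt M j t) :
    ∃ M', DownN j d M' M ∧ ∀ c, (j, c) ∈ M' ↔ (j, c) ∈ M ∧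
      ¬ ((∀ y, y ≤ c → rowHt M j y < rowHt M j (c + 1)) ∧
        ∀ y, c < y → rowHt M j y - d < rowHt M j (c + 1)) := by
  induction d generalizing M with
  | zero =>
    refine ⟨M, rfl, fun c => ⟨fun h => ⟨h, ?_⟩, fun h => h.1⟩⟩
    rintro ⟨-, h2⟩
    have := h2 (c + 1) (by omega)
    simp at this
  | succ d ih =>
    obtain ⟨t, ht'⟩ := hd
    push_cast at ht'
    -- The first maximum c + 1 marks the rightmost unmatched lower ball c. It is raised first, and
    -- the induction raises the next d.
    obtain ⟨m, h1, h2⟩ := exists_first_argmax (rowHt M j) (n + 1) 0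
      fun t ht => rowHt_eq_zero hM j (by omega)
    have hm : m ≠ 0 := by
      rintro rfl
      have := h1 t
      omega
    obtain ⟨c, rfl⟩ : ∃ k, m = k + 1 := ⟨m - 1, by omega⟩
    obtain ⟨m1, m2, hD⟩ := downAt_moveBall h1 fun t ht => h2 t (by omega)
    set M₁ := moveBall M (j, c) (j + 1, c) with hM₁
    have hG : InGrid L n M₁ := hD.inGrid_of hM hjL
    have hH : ∀ t, rowHt M₁ j t = rowHt M j t + if t ≤ c then 2 else 0 := by
      intro t
      have := hD.rowHt_eq t
      split_ifs at this ⊢ <;> omega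
    have a1 := rowHt_succ M j c
    have d1 := ind_eq_one.2 m1
    have d2 := ind_eq_zero.2 m2
    obtain ⟨M', g1, g2⟩ := ih hG ⟨c, by
      rw [hH, hH, if_pos (Nat.zero_le _), if_pos le_rfl]
      have := h1 t
      omega⟩
    refine ⟨M', g1.snoc ⟨c, hD⟩, fun b => ?_⟩
    rw [g2]
    have hb : (j, b) ∈ M₁ ↔ (j, b) ∈ M ∧ b ≠ c := by
      rw [hM₁, mem_moveBall]
      simp
      tauto
    rw [hb]
    -- Raising c shifts the heights up to c by 2, which lifts the maximum by one. The offset d + 1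
    -- in M thus becomes d in M₁ for the other unmatched balls.
    have key : ((∀ y, y ≤ b → rowHt M j y < rowHt M j (b + 1)) ∧
        ∀ y, b < y → rowHt M j y - ((d + 1 : ℕ) : ℤ) < rowHt M j (b + 1)) ↔ (b = c ∨
        ((∀ y, y ≤ b → rowHt M₁ j y < rowHt M₁ j (b + 1)) ∧
        ∀ y, b < y → rowHt M₁ j y - d < rowHt M₁ j (b + 1))) := by
      push_cast
      constructor
      · rintro ⟨k1, k2⟩
        rcases lt_trichotomy b c with hbc | hbc | hbc
        · right
          refine ⟨fun y hy => ?_, fun y hy => ?_⟩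
          · rw [hH, hH, if_pos (by omega), if_pos (by omega)]
            have := k1 y hy
            omega
          · rw [hH, hH, if_pos (show b + 1 ≤ c by omega)]
            have := k2 (c + 1) (by omega)
            have := h1 y
            have := h2 y
            split_ifs <;> omega
        · exact Or.inl hbc
        · have := k1 (c + 1) (by omega)
          have := h1 (b + 1)
          omega
      · rintro (rfl | ⟨k1, k2⟩)
        · refine ⟨fun y hy => h2 y (by omega), fun y _ => ?_⟩
          have := h1 y
          omega
        · have hbc : b < c := by
            by_contra hcon
            have := k1 c (by omega)
            rw [hH, hH, if_pos le_rfl, if_neg (by omega)] at this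
            have := h1 (b + 1)
            omega
          refine ⟨fun y hy => ?_, fun y hy => ?_⟩
          · have := k1 y hy
            rw [hH, hH, if_pos (by omega), if_pos (by omega)] at this
            omega
          · have := k2 c (by omega)
            rw [hH, hH, if_pos le_rfl, if_pos (by omega)] at this
            have := h1 y
            omega
    rw [key]
    tauto

/-- `[(k, f k), …, (1, f 1)]` -/
def upList (f : ℕ → ℕ) : ℕ → List (ℕ × ℕ)
  | 0 => []
  | k + 1 => (k + 1, f (k + 1)) :: upList f k

theorem mem_upList {f : ℕ → ℕ} {k : ℕ} {p : ℕ × ℕ} (h : p ∈ upList f k) : 1 ≤ p.1 ∧ p.1 ≤ k := by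
  induction k with
  | zero => simp [upList] at h
  | succ k ih =>
    simp only [upList, List.mem_cons] at h
    rcases h with rfl | h
    · simp
    · have := ih h; omega

theorem push_congr {M M' : Arr} {r : ℕ} (h : ∀ j, j ≤ r → rowSet M j = rowSet M' j)
    (Z : Finset ℕ) : push M r Z = push M' r Z := by
  induction r generalizing Z with
  | zero => rfl
  | succ r ih => rw [push, push, h (r + 1) le_rfl, ih fun j hj => h j (by omega)]

/-- Iterated matching through the rows `k, …, 1` is the bottom row after a sequence of inverse row
droppings. -/
theorem exists_upSeq_push {L n : ℕ} (f : ℕ → ℕ) (k : ℕ) {M : Arr} (hM : InGrid L n M)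
    (hk : k + 1 ≤ L)
    (hf : ∀ j, 1 ≤ j → j ≤ k → rowTail M j 0 = rowTail M (k + 1) 0 + f j) :
    ∃ N, UpSeq (upList f k) M N ∧ rowSet N 1 = push M k (rowSet M (k + 1)) := by
  induction k generalizing M with
  | zero => exact ⟨M, rfl, rfl⟩
  | succ k ih =>
    -- The surplus of the lower row equals the number of lifts, so the offset d in
    -- `exists_downN_raise` is exactly the wraparound term of `IsFree`: the balls left behind are
    -- the cyclically matched ones.
    have hH0 : rowHt M (k + 1) 0 = - (f (k + 1) : ℤ) := by
      rw [rowHt, hf (k + 1) (by omega) le_rfl]; ring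
    obtain ⟨M₁, h1, h2⟩ := exists_downN_raise (j := k + 1) (f (k + 1)) hM hk
      ⟨n + 1, by rw [rowHt_eq_zero hM _ (show n < n + 1 by omega), hH0]; omega⟩
    have hrow : rowSet M₁ (k + 1) = matched (rowSet M (k + 1 + 1)) (rowSet M (k + 1)) := by
      ext c
      rw [mem_matched, mem_rowSet, mem_rowSet, h2, IsFree]
      simp only [ht_rowSet, hH0, ← sub_eq_add_neg]
    have hlow : ∀ j, j ≤ k → rowSet M₁ j = rowSet M j := fun j hj =>
      (h1.rowSet_of_ne (by omega) (by omega)).symm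
    have hM₁ := h1.inGrid_of hM hk
    obtain ⟨N, g1, g2⟩ := ih hM₁ (by omega) (fun j hj hjk => by
      have e1 := h1.rowTail_zero j
      have e2 := h1.rowTail_zero (k + 1)
      rw [if_neg (by omega), if_neg (by omega)] at e1
      rw [if_pos rfl, if_neg (by omega)] at e2
      have e3 := hf j hj (by omega)
      have e4 := hf (k + 1) (by omega) le_rfl
      omega)
    refine ⟨N, ⟨M₁, h1, g1⟩, ?_⟩
    rw [g2, hrow, push_congr hlow, push]

/-! ### Deleting rightmost elements -/

/-- Delete from `D` its largest element outside `F`. -/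
def delTop {α : Type*} [LinearOrder α] (F D : Finset α) : Finset α :=
  if h : (D \ F).Nonempty then D.erase ((D \ F).max' h) else D

section DelTop

variable {α : Type*} [LinearOrder α] {F D : Finset α}

theorem delTop_eq_erase {c : α} (hc : c ∈ D) (hcF : c ∉ F) (h : ∀ b ∈ D, b ∉ F → b ≤ c) :
    delTop F D = D.erase c := by
  have hne : (D \ F).Nonempty := ⟨c, by simp [hc, hcF]⟩
  rw [delTop, dif_pos hne]
  congr 1
  refine le_antisymm (Finset.max'_le _ _ _ fun b hb => ?_) (Finset.le_max' _ _ (by simp [hc, hcF]))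
  simp only [Finset.mem_sdiff] at hb
  exact h b hb.1 hb.2

theorem delTop_eq_self (h : D ⊆ F) : delTop F D = D := by
  rw [delTop, dif_neg]
  rw [Finset.not_nonempty_iff_eq_empty, Finset.sdiff_eq_empty_iff_subset]
  exact h

theorem delTop_cases (F D : Finset α) : (D ⊆ F ∧ delTop F D = D) ∨
    ∃ c ∈ D, c ∉ F ∧ (∀ b ∈ D, b ∉ F → b ≤ c) ∧ delTop F D = D.erase c := by
  by_cases h : D ⊆ F
  · exact Or.inl ⟨h, delTop_eq_self h⟩
  · right
    have hne : (D \ F).Nonempty := by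
      rw [Finset.nonempty_iff_ne_empty, Ne, Finset.sdiff_eq_empty_iff_subset]; exact h
    have hm := Finset.max'_mem _ hne
    rw [Finset.mem_sdiff] at hm
    have hle : ∀ b ∈ D, b ∉ F → b ≤ (D \ F).max' hne :=
      fun b hb hbF => Finset.le_max' _ _ (by simp [hb, hbF])
    exact ⟨_, hm.1, hm.2, hle, delTop_eq_erase hm.1 hm.2 hle⟩

theorem delTop_subset (F D : Finset α) : delTop F D ⊆ D := by
  rcases delTop_cases F D with ⟨-, h⟩ | ⟨c, -, -, -, h⟩ <;> rw [h]
  exact Finset.erase_subset _ _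

theorem subset_delTop (h : F ⊆ D) : F ⊆ delTop F D := by
  rcases delTop_cases F D with ⟨-, h'⟩ | ⟨c, -, hc, -, h'⟩ <;> rw [h']
  · exact h
  · intro x hx
    exact Finset.mem_erase.2 ⟨fun e => hc (e ▸ hx), h hx⟩

theorem iterate_delTop_subset (F D : Finset α) (a : ℕ) : (delTop F)^[a] D ⊆ D := by
  induction a with
  | zero => exact subset_rfl
  | succ a ih => rw [Function.iterate_succ_apply']; exact (delTop_subset _ _).trans ih

theorem subset_iterate_delTop (h : F ⊆ D) (a : ℕ) : F ⊆ (delTop F)^[a] D := by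
  induction a with
  | zero => exact h
  | succ a ih => rw [Function.iterate_succ_apply']; exact subset_delTop ih

theorem delTop_map {β : Type*} [LinearOrder β] (e : α ↪o β) (F D : Finset α) :
    delTop (F.map e.toEmbedding) (D.map e.toEmbedding) = (delTop F D).map e.toEmbedding := by
  rcases delTop_cases F D with ⟨h1, h⟩ | ⟨c, h1, h2, h3, h⟩ <;> rw [h]
  · exact delTop_eq_self (Finset.map_subset_map.2 h1)
  · rw [Finset.map_erase]
    refine delTop_eq_erase (Finset.mem_map_of_mem _ h1) ?_ ?_
    · simpa using h2
    · intro b hb hbF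
      rw [Finset.mem_map] at hb
      obtain ⟨b, hb, rfl⟩ := hb
      simp only [RelEmbedding.coe_toEmbedding, OrderEmbedding.le_iff_le]
      exact h3 b hb fun hF => hbF (Finset.mem_map_of_mem _ hF)

/-- Starting from the sets `K m, K (m + 1), …`, delete from each one its largest elements outside
the result for the next one, as often as the list prescribes. -/
def trim (K : ℕ → Finset α) : ℕ → List ℕ → Finset α
  | m, [] => K m
  | m, a :: as => (delTop (trim K (m + 1) as))^[a] (K m)

/-- Deleting largest elements depends only on the order, so `trim` may be computed on positions
instead of columns. It evaluates K only at indices from m to m + as.length. -/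
theorem trim_map {β : Type*} [LinearOrder β] (e : α ↪o β) (κ : ℕ → Finset α) (K : ℕ → Finset β)
    (as : List ℕ) (m : ℕ) (h : ∀ k, m ≤ k → k ≤ m + as.length → K k = (κ k).map e.toEmbedding) :
    trim K m as = (trim κ m as).map e.toEmbedding := by
  induction as generalizing m with
  | nil => exact h m le_rfl (by simp)
  | cons a as ih =>
    rw [trim, trim, ih (m + 1) fun k h1 h2 => h k (by omega) (by simp; omega),
      h m le_rfl (by simp)]
    clear h
    generalize κ m = D
    induction a generalizing D with
    | zero => rfl
    | succ a iha => rw [Function.iterate_succ_apply, Function.iterate_succ_apply, delTop_map, iha]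

end DelTop

/-! ### Matching without wrapping -/

/-- With nonpositive heights, y = 0 gives ht 0 < ht (c + 1), which already implies the wraparound
inequalities: the pairing never wraps. -/
theorem isFree_iff {X Q : Finset ℕ} (h : ∀ t, ht X Q t ≤ 0) {c : ℕ} :
    IsFree X Q c ↔ ∀ y, y ≤ c → ht X Q y < ht X Q (c + 1) :=
  ⟨fun hc => hc.1, fun hc => ⟨hc, fun y _ => by
    have := h y
    have := hc 0 (Nat.zero_le c)
    omega⟩⟩

theorem ht_mono {X Y : Finset ℕ} (h : X ⊆ Y) (Q : Finset ℕ) (t : ℕ) : ht X Q t ≤ ht Y Q t := by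
  have := tl_mono h t
  unfold ht
  omega

theorem tl_eq_add_sdiff {F D : Finset ℕ} (h : F ⊆ D) (t : ℕ) : tl D t = tl F t + tl (D \ F) t := by
  unfold tl
  rw [← Nat.cast_add, ← Finset.card_union_of_disjoint]
  · rw [← Finset.filter_union, Finset.union_sdiff_of_subset h]
  · exact Finset.disjoint_filter_filter Finset.disjoint_sdiff

theorem matched_mono {F D Q : Finset ℕ} (h : F ⊆ D) (hD : ∀ t, ht D Q t ≤ 0) :
    matched F Q ⊆ matched D Q := by
  intro c hc
  rw [mem_matched] at hc ⊢
  refine ⟨hc.1, fun hf => hc.2 ?_⟩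
  rw [isFree_iff hD] at hf
  rw [isFree_iff fun t => (ht_mono h Q t).trans (hD t)]
  intro y hy
  have h1 := hf y hy
  have h2 := tl_antitone (D \ F) (show y ≤ c + 1 by omega)
  rw [ht, ht, tl_eq_add_sdiff h, tl_eq_add_sdiff h] at h1
  rw [ht, ht]
  omega

/-- Put back the deleted x: the ball newly matched is the first E-free p ≥ x. To the right of x the
sets E and F have equal tails, so a D-matched c > p outside the F-matched set would be free for F,
hence for E. Thus p is the largest D-matched element outside the F-matched set. -/
theorem matched_delTop {F D Q : Finset ℕ} (h : F ⊆ D) (hD : ∀ t, ht D Q t ≤ 0) :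
    matched (delTop F D) Q = delTop (matched F Q) (matched D Q) := by
  rcases delTop_cases F D with ⟨h1, h2⟩ | ⟨x, hx, hxF, hmax, h2⟩
  · obtain rfl : F = D := Finset.Subset.antisymm h h1
    rw [h2, delTop_eq_self subset_rfl]
  rw [h2]
  set E := D.erase x with hE
  have hxE : x ∉ E := Finset.notMem_erase x D
  have hins : insert x E = D := Finset.insert_erase hx
  have hFE : F ⊆ E := fun a ha => Finset.mem_erase.2 ⟨fun e => hxF (e ▸ ha), h ha⟩
  have hEneg : ∀ t, ht E Q t ≤ 0 := fun t => (ht_mono (Finset.erase_subset x D) Q t).trans (hD t)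
  have hFneg : ∀ t, ht F Q t ≤ 0 := fun t => (ht_mono h Q t).trans (hD t)
  have hElt : ∀ t, t ≤ x → ht E Q t < 0 := by
    intro t htx
    have h3 := hD t
    rw [← hins, ht_insert hxE, if_pos htx] at h3
    omega
  obtain ⟨p, hxp, hpf, hpmin⟩ : ∃ p, x ≤ p ∧ IsFree E Q p ∧ ∀ c, IsFree E Q c → x ≤ c → p ≤ c := by
    have hex : ∃ c, x ≤ c ∧ IsFree E Q c := by
      obtain ⟨N, hN⟩ := exists_ht_eq_zero E Q
      obtain ⟨m, m1, m2⟩ := exists_first_argmax (ht E Q) N 0 hN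
      have h3 := m1 N
      rw [hN N le_rfl] at h3
      have hxm : x < m := by
        by_contra hcon
        have := hElt m (by omega)
        omega
      refine ⟨m - 1, by omega, ?_⟩
      rw [isFree_iff hEneg, show m - 1 + 1 = m by omega]
      exact fun y hy => m2 y (by omega)
    classical
    exact ⟨Nat.find hex, (Nat.find_spec hex).1, (Nat.find_spec hex).2,
      fun c hc hxc => Nat.find_min' hex ⟨hxc, hc⟩⟩
  have hfree := isFree_insert hxE (hElt 0 (Nat.zero_le x)) ⟨hpf, Or.inl ⟨hxp, hpmin⟩⟩
  rw [hins] at hfree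
  have hpF : p ∉ matched F Q := fun hm =>
    (mem_matched.1 (matched_mono hFE hEneg hm)).2 hpf
  have htail : ∀ t, x ≤ t → ht E Q t = ht F Q t := by
    intro t htx
    rw [ht, ht, tl_eq_add_sdiff hFE, tl_eq_zero (S := E \ F), add_zero]
    intro c hc
    simp only [hE, Finset.mem_sdiff, Finset.mem_erase] at hc
    have := hmax c hc.1.2 hc.2
    omega
  have herase : delTop (matched F Q) (matched D Q) = (matched D Q).erase p := by
    refine delTop_eq_erase ?_ hpF ?_
    · rw [mem_matched, hfree]
      exact ⟨hpf.mem, by simp⟩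
    · intro c hc hcF
      by_contra hcp
      rw [mem_matched, hfree] at hc
      have hcE : ¬ IsFree E Q c := fun hcE => hc.2 ⟨hcE, by omega⟩
      have hcF' : IsFree F Q c := by
        by_contra hcon
        exact hcF (mem_matched.2 ⟨hc.1, hcon⟩)
      apply hcE
      rw [isFree_iff hEneg]
      rw [isFree_iff hFneg] at hcF'
      intro y hy
      have e1 := htail (c + 1) (by omega)
      rcases le_or_gt x y with hxy | hxy
      · rw [htail y hxy, e1]; exact hcF' y hy
      · have e2 := hpf.1 y (by omega)
        have e3 := htail (p + 1) (by omega)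
        have e4 := hcF' (p + 1) (by omega)
        omega
  rw [herase]
  ext c
  rw [Finset.mem_erase, mem_matched, mem_matched, hfree]
  constructor
  · rintro ⟨h3, h4⟩
    exact ⟨fun e => h4 (e ▸ hpf), h3, fun h5 => h4 h5.1⟩
  · rintro ⟨h3, h4, h5⟩
    exact ⟨h4, fun h6 => h5 ⟨h6, h3⟩⟩

theorem matched_iterate_delTop {F D Q : Finset ℕ} (h : F ⊆ D) (hD : ∀ t, ht D Q t ≤ 0) (a : ℕ) :
    matched ((delTop F)^[a] D) Q = (delTop (matched F Q))^[a] (matched D Q) := by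
  induction a with
  | zero => rfl
  | succ a ih =>
    rw [Function.iterate_succ_apply', Function.iterate_succ_apply', ← ih]
    exact matched_delTop (subset_iterate_delTop h a) fun t =>
      (ht_mono (iterate_delTop_subset F D a) Q t).trans (hD t)

/-! ### Pushing deletions down to the bottom row -/

section Push

variable {L n : ℕ} {N : Arr}

theorem RowHighest.null (hr : RowHighest L N) (hN : InGrid L n N) {j : ℕ} (hj : 1 ≤ j) :
    Null j N := by
  by_cases hjL : j + 1 ≤ L
  · exact hr j hj hjL
  · rw [null_iff]
    intro t
    rw [← tl_rowSet, rowSet_eq_empty hN (by omega)]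
    simpa [tl] using rowTail_nonneg N j t

theorem RowHighest.ht_le (hr : RowHighest L N) (hN : InGrid L n N) {j : ℕ} (hj : 1 ≤ j)
    {Z : Finset ℕ} (hZ : Z ⊆ rowSet N (j + 1)) (t : ℕ) : ht Z (rowSet N j) t ≤ 0 := by
  refine (ht_mono hZ _ t).trans ?_
  rw [ht_rowSet]
  exact hr.null hN hj t

/-- Highest weight makes every height nonpositive, so `matched_iterate_delTop` applies in each row.
-/
theorem push_iterate_delTop (hr : RowHighest L N) (hN : InGrid L n N) (r : ℕ) {F D : Finset ℕ}
    (h : F ⊆ D) (hD : D ⊆ rowSet N (r + 1)) (a : ℕ) :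
    push N r ((delTop F)^[a] D) = (delTop (push N r F))^[a] (push N r D) := by
  induction r generalizing F D with
  | zero => rfl
  | succ r ih =>
    have hle := hr.ht_le hN (j := r + 1) (by omega) hD
    rw [push, push, push, matched_iterate_delTop h hle]
    exact ih (matched_mono h hle) (matched_subset _ _)

/-- The bottom rows produced by inverse row droppings, as sets in the rows of `N`. -/
noncomputable def rowTrim (N : Arr) : ℕ → List ℕ → Finset ℕ
  | m, [] => rowSet N m
  | m, a :: as => (delTop (matched (rowTrim N (m + 1) as) (rowSet N m)))^[a] (rowSet N m)

/-- Pushing the deletions down makes all of them happen in one row, among the sets `push N (m - 1)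
(rowSet N m)`, which are the label sets of N in the bottom row. -/
theorem push_rowTrim (hr : RowHighest L N) (hN : InGrid L n N) (as : List ℕ) (r : ℕ) :
    push N r (rowTrim N (r + 1) as) = trim (fun m => push N (m - 1) (rowSet N m)) (r + 1) as := by
  induction as generalizing r with
  | nil => simp [rowTrim, trim]
  | cons a as ih =>
    rw [rowTrim, trim, push_iterate_delTop hr hN r (matched_subset _ _) subset_rfl, ← ih (r + 1),
      push]
    simp

end Push

/-- Undoing a dropping raises the rightmost unmatched lower ball and leaves the other unmatched ones
unmatched. The strengthened induction therefore carries along that the unmatched balls of the lower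
row are exactly those outside the fixed set F. -/
theorem DownN.rowSet_lower {j a : ℕ} {M N : Arr} (h : DownN j a M N) (hN : Null j N) :
    rowSet M j = (delTop (matched (rowSet N (j + 1)) (rowSet N j)))^[a] (rowSet N j) := by
  set F := matched (rowSet N (j + 1)) (rowSet N j) with hF
  suffices h' : rowSet M j = (delTop F)^[a] (rowSet N j) ∧
      ∀ c, (c ∈ rowSet M j ∧ c ∉ F) ↔ ∀ y, y ≤ c → rowHt M j y < rowHt M j (c + 1) from h'.1
  induction a generalizing M with
  | zero =>
    obtain rfl : M = N := h
    refine ⟨rfl, fun c => ?_⟩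
    have hfree := isFree_iff (X := rowSet M (j + 1)) (Q := rowSet M j) (fun t => by
      rw [ht_rowSet]; exact hN t) (c := c)
    simp only [ht_rowSet] at hfree
    rw [← hfree, hF, mem_matched]
    constructor
    · rintro ⟨h1, h2⟩
      by_contra h3
      exact h2 ⟨h1, h3⟩
    · intro h1
      exact ⟨h1.mem, fun h2 => h2.2 h1⟩
  | succ a ih =>
    obtain ⟨M', ⟨c, h1⟩, h2⟩ := h
    obtain ⟨g1, g2⟩ := ih h2
    obtain ⟨r1, r2, r3⟩ := h1.reverse
    have hc := (g2 c).2 r2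
    have hrow : rowSet M j = (rowSet M' j).erase c := by
      ext x
      rw [Finset.mem_erase, mem_rowSet, mem_rowSet, r3, mem_moveBall]
      simp
    refine ⟨?_, fun b => ?_⟩
    · rw [Function.iterate_succ_apply', ← g1, hrow]
      symm
      refine delTop_eq_erase hc.1 hc.2 fun b hb hbF => ?_
      by_contra hcb
      have := (g2 b).1 ⟨hb, hbF⟩ (c + 1) (by omega)
      have := r1 (b + 1)
      omega
    · have hH : ∀ t, rowHt M j t = rowHt M' j t + if t ≤ c then 2 else 0 := by
        intro t
        have := h1.rowHt_eq t
        split_ifs at this ⊢ <;> omega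
      have hH1 : rowHt M' j (c + 1) ≤ rowHt M' j c + 1 := by
        have := rowHt_succ M' j c
        have := ind_le_one M' j c
        have := ind_nonneg M' (j + 1) c
        omega
      rw [hrow, Finset.mem_erase, and_assoc, g2 b]
      constructor
      · rintro ⟨h3, h4⟩ y hy
        have hbc : b < c := by
          by_contra hcon
          have := h4 (c + 1) (by omega)
          have := r1 (b + 1)
          omega
        rw [hH, hH, if_pos (by omega), if_pos (by omega)]
        have := h4 y hy
        omega
      · intro h3
        have hbc : b < c := by
          by_contra hcon
          have := h3 c (by omega)
          rw [hH, hH, if_pos le_rfl, if_neg (by omega)] at this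
          have := r1 (b + 1)
          omega
        refine ⟨by omega, fun y hy => ?_⟩
        have := h3 y hy
        rw [hH, hH, if_pos (by omega), if_pos (by omega)] at this
        omega

/-- The lowest row before an ascending sweep of row droppings, in terms of the result. -/
theorem DSeq.rowSet_eq_rowTrim (k m : ℕ) (as : List ℕ) (M N : Arr)
    (h : DSeq (List.range' m k) as M N) : rowSet M m = rowTrim N m as := by
  induction k generalizing m as M with
  | zero =>
    cases as with
    | nil => obtain rfl : M = N := h; rfl
    | cons => exact h.elim
  | succ k ih =>
    cases as with
    | nil => exact h.elim
    | cons a as =>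
      obtain ⟨M', h1, h2⟩ := h
      rw [rowTrim, ← ih (m + 1) as M' h2, h1.1.rowSet_lower h1.2,
        DSeq.rowSet_of_lt (r := m) h2 fun j hj => by rw [List.mem_range'_1] at hj; omega]

theorem DSeq.length_eq {js as : List ℕ} {M N : Arr} (h : DSeq js as M N) :
    as.length = js.length := by
  induction js generalizing as M with
  | nil =>
    cases as with
    | nil => rfl
    | cons => exact h.elim
  | cons j js ih =>
    cases as with
    | nil => exact h.elim
    | cons a as =>
      obtain ⟨M', h1, h2⟩ := h
      simp [ih h2]

/-! ### Exponents attached to a component -/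

section Exponents

variable {L n : ℕ}

/-- The row operators that lead from an arrangement to its highest weight: first all those that
fix the bottom row, then one ascending sweep. -/
def sweepList (L : ℕ) : List ℕ := collapseList 2 (L - 2) ++ List.range' 1 (L - 1)

theorem mem_sweepList {j : ℕ} (h : j ∈ sweepList L) : 1 ≤ j ∧ j + 1 ≤ L := by
  rw [sweepList, List.mem_append, List.mem_range'_1] at h
  rcases h with h | h
  · have := mem_collapseList h; omega
  · omega

/-- The lengths of the sequences of row operators that lead from `M` to `ρ(M)`, through an
arrangement whose bottom row consists of the balls of label greater than `k`. -/
def HasExponents (L n : ℕ) (f : ℕ → ℕ) (k : ℕ) (as : List ℕ) (M : Arr) : Prop :=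
  ∃ P, UpSeq (upList f k) M P ∧ DSeq (sweepList L) as P (rho L n M)

theorem exists_dSeq_rho (hL : 1 ≤ L) {M : Arr} (hM : InGrid L n M) :
    ∃ as, DSeq (collapseList 1 (L - 1)) as M (rho L n M) :=
  exists_dSeq_collapseUpTo (by omega) hM

theorem mem_collapseList_one {j : ℕ} (h : j ∈ collapseList 1 (L - 1)) : 1 ≤ j ∧ j + 1 ≤ L := by
  have := mem_collapseList h
  omega

theorem inGrid_rho (hL : 1 ≤ L) {M : Arr} (hM : InGrid L n M) : InGrid L n (rho L n M) := by
  obtain ⟨as, h⟩ := exists_dSeq_rho hL hM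
  exact h.inGrid hM fun j hj => (mem_collapseList_one hj).1

theorem rowHighest_rho (hL : 1 ≤ L) {M : Arr} (hM : InGrid L n M) :
    RowHighest L (rho L n M) := by
  obtain ⟨as, h⟩ := exists_dSeq_rho hL hM
  exact fun j hj hjL => h.null_collapseList le_rfl (L - 1) as M _ hM j hj (by omega)

/-- Transport the dropping sequence of M along the column operator; droppings are deterministic, so
the transported sequence is the collapse of the image. -/
theorem rho_fRight (hL : 1 ≤ L) {M : Arr} (hM : InGrid L n M) {i : ℕ} (hi : 1 ≤ i)
    (hin : i + 1 ≤ n) : rho L n (fRight L n i M) = fRight L n i (rho L n M) := by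
  obtain ⟨as, h⟩ := exists_dSeq_rho hL hM
  have hM' := fRight_inGrid hM hi hin
  obtain ⟨as', h'⟩ := exists_dSeq_rho hL hM'
  exact (h'.unique hM' (fun j hj => (mem_collapseList_one hj).1)
    (h.fRight hM hi hin fun j hj => mem_collapseList_one hj)).2

theorem HasExponents.fRight (hL : 1 ≤ L) {f : ℕ → ℕ} {k : ℕ} (hk : k + 1 ≤ L) {as : List ℕ}
    {M : Arr} (h : HasExponents L n f k as M) (hM : InGrid L n M) {i : ℕ} (hi : 1 ≤ i)
    (hin : i + 1 ≤ n) : HasExponents L n f k as (fRight L n i M) := by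
  obtain ⟨P, h1, h2⟩ := h
  have hu : ∀ p ∈ upList f k, 1 ≤ p.1 ∧ p.1 + 1 ≤ L := fun p hp => by
    have := mem_upList hp; omega
  refine ⟨_, h1.fRight hM hi hin hu, ?_⟩
  rw [rho_fRight hL hM hi hin]
  exact h2.fRight (h1.inGrid hM fun p hp => (hu p hp).2) hi hin fun j hj => mem_sweepList hj

theorem HasExponents.unique {f : ℕ → ℕ} {k : ℕ} (hk : k + 1 ≤ L) {as as' : List ℕ}
    {M : Arr} (h : HasExponents L n f k as M) (h' : HasExponents L n f k as' M)
    (hM : InGrid L n M) : as = as' := by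
  obtain ⟨P, h1, h2⟩ := h
  obtain ⟨P', h3, h4⟩ := h'
  obtain rfl := h1.unique h3
  exact (h2.unique (h1.inGrid hM fun p hp => by have := mem_upList hp; omega)
    (fun j hj => (mem_sweepList hj).1) h4).1

/-- At a source M₀, both the highest weight arrangement reached from P and ρ(M₀) are highest weight
in both directions with the column contents of M₀, hence equal. The exponents are then transported
from M₀ to M. -/
theorem exists_hasExponents (hL : 1 ≤ L) {f : ℕ → ℕ} {k : ℕ} (hk : k + 1 ≤ L) {M : Arr}
    (hM : InGrid L n M)
    (hf : ∀ j, 1 ≤ j → j ≤ k → rowTail M j 0 = rowTail M (k + 1) 0 + f j) :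
    ∃ as, HasExponents L n f k as M := by
  obtain ⟨M₀, g1, g2, g3, g4⟩ := exists_colHighest hM
  have hu : ∀ p ∈ upList f k, 1 ≤ p.1 ∧ p.1 + 1 ≤ L := fun p hp => by
    have := mem_upList hp; omega
  obtain ⟨as, h⟩ : ∃ as, HasExponents L n f k as M₀ := by
    obtain ⟨P, h1, -⟩ := exists_upSeq_push f k g1 hk fun j hj hjk => by
      rw [g3, g3]; exact hf j hj hjk
    have hP := h1.inGrid g1 fun p hp => (hu p hp).2
    obtain ⟨as, N, h2⟩ := exists_dSeq (sweepList L) (fun j hj => mem_sweepList hj) hP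
    obtain ⟨as₁, as₂, Q, -, h3, h4⟩ := h2.of_append
    have hQ := h3.inGrid hP fun j hj => by have := mem_collapseList hj; omega
    have hrow : RowHighest L N := fun j hj hjL =>
      h4.null_ascending (L - 1) as₂ Q N hQ (fun j hj hjL =>
        h3.null_collapseList (by omega) (L - 2) as₁ P Q hP j hj (by omega)) j hj (by omega)
    obtain ⟨bs, h5⟩ := exists_dSeq_rho hL g1
    have : N = rho L n M₀ := by
      refine eq_of_highest (h2.inGrid hP fun j hj => (mem_sweepList hj).1) (inGrid_rho hL g1) hrow
        (rowHighest_rho hL g1) ?_ ?_ fun c => ?_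
      · rw [h2.colHighest_iff fun j hj => (mem_sweepList hj).1,
          h1.colHighest_iff fun p hp => (hu p hp).1]
        exact g2
      · rw [h5.colHighest_iff fun j hj => (mem_collapseList_one hj).1]
        exact g2
      · rw [h2.colHead_top fun j hj => (mem_sweepList hj).2,
          h1.colHead_top fun p hp => (hu p hp).2,
          h5.colHead_top fun j hj => (mem_collapseList_one hj).2]
    exact ⟨as, P, h1, this ▸ h2⟩
  refine ⟨as, ?_⟩
  have key : InGrid L n M ∧ HasExponents L n f k as M := by
    clear hM hf g3
    induction g4 with
    | refl => exact ⟨g1, h⟩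
    | tail _ hstep ih =>
      obtain ⟨i, hi, hin, rfl⟩ := hstep
      exact ⟨fRight_inGrid ih.1 hi hin, ih.2.fRight hL hk ih.1 hi hin⟩
  exact key.2

theorem rowTail_zero_eq_card (M : Arr) (r : ℕ) : rowTail M r 0 = (rowSet M r).card := by
  rw [← tl_rowSet, tl_zero]

theorem RowHighest.card_le {N : Arr} (hr : RowHighest L N) (r : ℕ) (h1 : 1 ≤ r) (h2 : r + 1 ≤ L) :
    (rowSet N (r + 1)).card ≤ (rowSet N r).card := by
  have := null_iff.1 (hr r h1 h2) 0
  rw [rowTail_zero_eq_card, rowTail_zero_eq_card] at this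
  exact_mod_cast this

/-- The balls with large labels are determined by the labels of `ρ(M)` and the exponents. -/
theorem HasExponents.geSet_label {f : ℕ → ℕ} {k : ℕ} (hk : k + 1 ≤ L)
    {as : List ℕ} {M : Arr} (h : HasExponents L n f k as M) (hM : InGrid L n M)
    (hcard : ∀ r, 1 ≤ r → r + 1 ≤ L → (rowSet M (r + 1)).card ≤ (rowSet M r).card)
    (hf : ∀ j, 1 ≤ j → j ≤ k → rowTail M j 0 = rowTail M (k + 1) 0 + f j) :
    geSet n (label L n M 1) (k + 1) =
      trim (geSet n (label L n (rho L n M) 1)) 1 (as.drop (collapseList 2 (L - 2)).length) := by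
  obtain ⟨P, h1, h2⟩ := h
  have hL : 1 ≤ L := by omega
  have hN := inGrid_rho hL hM
  have hr := rowHighest_rho hL hM
  rw [geSet_label_one hM hcard hk]
  obtain ⟨P', h1', hP'⟩ := exists_upSeq_push f k hM hk hf
  obtain rfl := h1.unique h1'
  rw [← hP']
  obtain ⟨as₁, as₂, Q, rfl, h3, h4⟩ := h2.of_append
  rw [← h3.length_eq, List.drop_left]
  rw [← h3.rowSet_of_lt (r := 1) fun j hj => (mem_collapseList hj).1,
    h4.rowSet_eq_rowTrim, show rowTrim (rho L n M) 1 as₂ = push (rho L n M) 0 _ from rfl,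
    push_rowTrim hr hN]
  have hlen := h4.length_eq
  rw [List.length_range'] at hlen
  -- The identity embedding serves as a congruence principle: the pushed rows and the label sets
  -- need to agree only at the indices 1, …, L that `trim` uses.
  have e := trim_map (RelEmbedding.refl (α := ℕ) (· ≤ ·))
    (fun m => push (rho L n M) (m - 1) (rowSet (rho L n M) m))
    (geSet n (label L n (rho L n M) 1)) as₂ 1 fun m hm1 hm2 => by
      obtain ⟨m, rfl⟩ : ∃ k, m = k + 1 := ⟨m - 1, by omega⟩
      rw [geSet_label_one hN hr.card_le (by omega)]
      simp
  rw [e]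
  simp

end Exponents

/-! ### The strong type -/

theorem filter_range'_eq_map {n k : ℕ} {S : Finset ℕ} (hS : ∀ c ∈ S, 1 ≤ c ∧ c ≤ n)
    (h : S.card = k) :
    (List.range' 1 n).filter (fun c => c ∈ S) = (List.finRange k).map (S.orderEmbOfFin h) := by
  rw [Finset.listMap_orderEmbOfFin_finRange]
  refine List.SortedLT.eq_of_mem_iff ?_ S.sortedLT_sort fun c => ?_
  · exact (List.Pairwise.filter _ List.pairwise_lt_range').sortedLT
  · simp only [List.mem_filter, List.mem_range'_1, decide_eq_true_eq, Finset.mem_sort]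
    constructor
    · exact fun h => h.2
    · exact fun h => ⟨by have := hS c h; omega, h⟩

/-- Only vanishing labels are skipped outside S. This lets the strong type of M be read along the
possibly larger bottom row of ρ(M). -/
theorem filter_map_range'_eq {n k : ℕ} {S : Finset ℕ} (hS : ∀ c ∈ S, 1 ≤ c ∧ c ≤ n)
    (h : S.card = k) (lab : ℕ → ℕ) (hlab : ∀ c, lab c ≠ 0 → c ∈ S) :
    ((List.range' 1 n).map lab).filter (fun a => a ≠ 0) =
      ((List.finRange k).map fun i => lab (S.orderEmbOfFin h i)).filter fun a => a ≠ 0 := by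
  have e : ((List.finRange k).map fun i => lab (S.orderEmbOfFin h i)) =
      ((List.finRange k).map (S.orderEmbOfFin h)).map lab := by
    rw [List.map_map]; rfl
  rw [e, ← filter_range'_eq_map hS h, List.filter_map, List.filter_map, List.filter_filter]
  congr 1
  apply List.filter_congr
  intro c _
  by_cases h0 : lab c = 0
  · simp [h0]
  · simp [h0, hlab c h0]

section Final

variable {L n : ℕ}

theorem IsLabelling.ne_zero_iff {B : Finset ℕ} {lab : ℕ → ℕ} (h : IsLabelling L 1 B lab) (c : ℕ) :
    lab c ≠ 0 ↔ c ∈ B := by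
  constructor
  · intro h0
    by_contra hc
    exact h0 ((h c).2 hc)
  · intro hc
    have := ((h c).1 hc).1
    omega

theorem isLabelling_label_one (hL : 1 ≤ L) {M : Arr} (hM : InGrid L n M)
    (hcard : ∀ r, 1 ≤ r → r + 1 ≤ L → (rowSet M (r + 1)).card ≤ (rowSet M r).card) :
    IsLabelling L 1 (rowSet M 1) (label L n M 1) :=
  (label_spec hM hcard (L - 1) 1 le_rfl (by omega)).1

theorem trim_subset {α : Type*} [LinearOrder α] (K : ℕ → Finset α) (m : ℕ) (as : List ℕ) :
    trim K m as ⊆ K m := by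
  cases as with
  | nil => exact subset_rfl
  | cons a as => exact iterate_delTop_subset _ _ _

/-- The labels of the bottom row of `M`, read along the bottom row of `ρ(M)`, are determined by the
labels of `ρ(M)` and the exponents. -/
theorem le_label_iff (hL : 1 ≤ L) {f : ℕ → ℕ} {k : ℕ} (hk : k + 1 ≤ L) {as : List ℕ} {M : Arr}
    (h : HasExponents L n f k as M) (hM : InGrid L n M)
    (hcard : ∀ r, 1 ≤ r → r + 1 ≤ L → (rowSet M (r + 1)).card ≤ (rowSet M r).card)
    (hf : ∀ j, 1 ≤ j → j ≤ k → rowTail M j 0 = rowTail M (k + 1) 0 + f j) {m : ℕ}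
    (hm : (rowSet (rho L n M) 1).card = m) (i : Fin m) :
    k + 1 ≤ label L n M 1 ((rowSet (rho L n M) 1).orderEmbOfFin hm i) ↔
      i ∈ trim (fun r => Finset.univ.filter fun i =>
        r ≤ label L n (rho L n M) 1 ((rowSet (rho L n M) 1).orderEmbOfFin hm i)) 1
          (as.drop (collapseList 2 (L - 2)).length) := by
  set e := (rowSet (rho L n M) 1).orderEmbOfFin hm with he
  have hN := inGrid_rho hL hM
  have hr := rowHighest_rho hL hM
  have hlab := isLabelling_label_one hL hN hr.card_le
  have hbd := bounds_of_mem_rowSet hN 1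
  have hei : ∀ i, e i ∈ rowSet (rho L n M) 1 := fun i => Finset.orderEmbOfFin_mem _ hm i
  have h1 : k + 1 ≤ label L n M 1 (e i) ↔ e i ∈ geSet n (label L n M 1) (k + 1) := by
    rw [mem_geSet]
    exact ⟨fun h => ⟨hbd _ (hei i), h⟩, fun h => h.2⟩
  rw [h1, h.geSet_label hk hM hcard hf, trim_map e
    (fun r => Finset.univ.filter fun i => r ≤ label L n (rho L n M) 1 (e i)) _ _ 1]
  · simp
  · intro r hr1 _
    ext c
    rw [mem_geSet, Finset.mem_map]
    constructor
    · rintro ⟨-, h3⟩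
      have hc : c ∈ rowSet (rho L n M) 1 := (hlab.ne_zero_iff c).1 (by omega)
      have : c ∈ Set.range e := by rw [he, Finset.range_orderEmbOfFin]; exact hc
      obtain ⟨i, rfl⟩ := this
      exact ⟨i, by simpa using h3, rfl⟩
    · rintro ⟨i, h3, rfl⟩
      exact ⟨hbd _ (hei i), by simpa using h3⟩

end Final

/-- All arrangements of a component have the same exponents. -/
theorem hasExponents_iff_of_sameComponent {lam : YoungDiagram} {n : ℕ} {M M' : MLQ lam n}
    (hcomp : SameComponent M M') {f : ℕ → ℕ} {k : ℕ} (hk : k + 1 ≤ numRows lam)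
    (hf : ∀ M : MLQ lam n, ∀ j, 1 ≤ j → j ≤ k →
      rowTail M.balls j 0 = rowTail M.balls (k + 1) 0 + f j) (as : List ℕ) :
    HasExponents (numRows lam) n f k as M.balls ↔ HasExponents (numRows lam) n f k as M'.balls := by
  have hL : 1 ≤ numRows lam := by omega
  have edge : ∀ A B : MLQ lam n, (crystalGraph lam n).Adj A B →
      (HasExponents (numRows lam) n f k as A.balls ↔
        HasExponents (numRows lam) n f k as B.balls) := by
    rintro A B ⟨i, hi, hin, hB⟩
    rw [hB]
    refine ⟨fun h => h.fRight hL hk A.subset_grid hi hin, fun h => ?_⟩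
    -- Against the direction of an edge nothing is transported: A has some exponents, they pass to
    -- B, and uniqueness at B identifies them with the given ones.
    obtain ⟨bs, h'⟩ := exists_hasExponents hL hk A.subset_grid (hf A)
    rw [h.unique hk (h'.fRight hL hk A.subset_grid hi hin) (hB ▸ B.subset_grid)]
    exact h'
  obtain ⟨w⟩ := hcomp
  induction w with
  | nil => exact Iff.rfl
  | cons hadj _ ih =>
    refine Iff.trans ?_ ih
    rcases hadj.2 with h | h
    · exact edge _ _ h
    · exact (edge _ _ h).symm

end MultilineQueue

theorem mainTheorem4 (lam : YoungDiagram) (n : ℕ) (M M' : MultilineQueue.MLQ lam n)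
    (hcomp : MultilineQueue.SameComponent M M')
    (hrho : MultilineQueue.strtype (MultilineQueue.numRows lam) n
        (MultilineQueue.rho (MultilineQueue.numRows lam) n M.balls) =
      MultilineQueue.strtype (MultilineQueue.numRows lam) n
        (MultilineQueue.rho (MultilineQueue.numRows lam) n M'.balls)) :
    MultilineQueue.strtype (MultilineQueue.numRows lam) n M.balls =
      MultilineQueue.strtype (MultilineQueue.numRows lam) n M'.balls := by
  open MultilineQueue in
  rcases Nat.eq_zero_or_pos (numRows lam) with hL0 | hL
  · have : ∀ A : MLQ lam n, A.balls = ∅ := fun A =>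
      Finset.subset_empty.1 (by simpa [hL0] using A.subset_grid)
    rw [this M, this M']
  have hrow : ∀ A : MLQ lam n, ∀ r, 1 ≤ r → r ≤ numRows lam →
      (rowSet A.balls r).card = lam.colLen (r - 1) := fun A r h1 h2 =>
    A.card_row r (Finset.mem_Icc.2 ⟨h1, h2⟩)
  have hcard : ∀ A : MLQ lam n, ∀ r, 1 ≤ r → r + 1 ≤ numRows lam →
      (rowSet A.balls (r + 1)).card ≤ (rowSet A.balls r).card := fun A r h1 h2 => by
    rw [hrow A _ (by omega) h2, hrow A r h1 (by omega)]
    exact lam.colLen_anti _ _ (by omega)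
  -- Row j has to be thinned to the size of row k + 1, so f j = λ'_j - λ'_{k+1}. The truncated
  -- subtraction is exact because column lengths decrease.
  have hf : ∀ k, k + 1 ≤ numRows lam → ∀ A : MLQ lam n, ∀ j, 1 ≤ j → j ≤ k →
      rowTail A.balls j 0 = rowTail A.balls (k + 1) 0 +
        ((lam.colLen (j - 1) - lam.colLen k : ℕ) : ℤ) := by
    intro k hk A j h1 h2
    rw [rowTail_zero_eq_card, rowTail_zero_eq_card, hrow A j h1 (by omega),
      hrow A (k + 1) (by omega) hk, Nat.add_sub_cancel]
    have := lam.colLen_anti (j - 1) k (by omega)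
    omega
  have hlabρ := fun A : MLQ lam n => isLabelling_label_one hL (inGrid_rho hL A.subset_grid)
    (rowHighest_rho hL A.subset_grid).card_le
  have hlab := fun A : MLQ lam n => isLabelling_label_one hL A.subset_grid (hcard A)
  have hbd := fun A : MLQ lam n => bounds_of_mem_rowSet (inGrid_rho hL A.subset_grid) 1
  have hstrρ : ∀ (A : MLQ lam n) (m : ℕ)
      (hm : (rowSet (rho (numRows lam) n A.balls) 1).card = m),
      strtype (numRows lam) n (rho (numRows lam) n A.balls) =
        (List.finRange m).map fun i => label (numRows lam) n (rho (numRows lam) n A.balls) 1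
          ((rowSet (rho (numRows lam) n A.balls) 1).orderEmbOfFin hm i) := by
    intro A m hm
    rw [strtype, type, filter_map_range'_eq (hbd A) hm _ fun c => ((hlabρ A).ne_zero_iff c).1,
      List.filter_eq_self]
    intro a ha
    rw [List.mem_map] at ha
    obtain ⟨i, -, rfl⟩ := ha
    exact decide_eq_true (((hlabρ A).ne_zero_iff _).2 (Finset.orderEmbOfFin_mem _ hm i))
  obtain ⟨m, hm⟩ : ∃ m, (rowSet (rho (numRows lam) n M.balls) 1).card = m := ⟨_, rfl⟩
  have hm' : (rowSet (rho (numRows lam) n M'.balls) 1).card = m := by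
    have h1 := congrArg List.length hrho
    rw [hstrρ M m hm, hstrρ M' _ rfl] at h1
    simpa using h1.symm
  rw [hstrρ M m hm, hstrρ M' m hm'] at hrho
  have heq : ∀ i : Fin m, label (numRows lam) n (rho (numRows lam) n M.balls) 1
        ((rowSet (rho (numRows lam) n M.balls) 1).orderEmbOfFin hm i) =
      label (numRows lam) n (rho (numRows lam) n M'.balls) 1
        ((rowSet (rho (numRows lam) n M'.balls) 1).orderEmbOfFin hm' i) :=
    fun i => List.map_inj_left.1 hrho i (List.mem_finRange i)
  have hle : ∀ (k : ℕ) (i : Fin m), k + 1 ≤ numRows lam →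
      (k + 1 ≤ label (numRows lam) n M.balls 1
        ((rowSet (rho (numRows lam) n M.balls) 1).orderEmbOfFin hm i) ↔
      k + 1 ≤ label (numRows lam) n M'.balls 1
        ((rowSet (rho (numRows lam) n M'.balls) 1).orderEmbOfFin hm' i)) := by
    intro k i hk
    -- The same exponents serve M and M', and the labels of the two collapsed arrangements agree
    -- position by position, so both sides are the same `trim` on `Fin m`.
    obtain ⟨as, h⟩ := exists_hasExponents hL hk M.subset_grid (hf k hk M)
    have h' := (hasExponents_iff_of_sameComponent hcomp hk (hf k hk) as).1 h
    rw [le_label_iff hL hk h M.subset_grid (hcard M) (hf k hk M) hm,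
      le_label_iff hL hk h' M'.subset_grid (hcard M') (hf k hk M') hm']
    simp only [heq]
  have hbound : ∀ (A : MLQ lam n) (c : ℕ), label (numRows lam) n A.balls 1 c ≤ numRows lam := by
    intro A c
    by_cases hc : c ∈ rowSet A.balls 1
    · exact ((hlab A c).1 hc).2
    · rw [(hlab A c).2 hc]; exact Nat.zero_le _
  -- The threshold k = 0 shows that the bottom row of A lies in that of ρ(A), since `trim` only
  -- deletes.
  have hsub : ∀ A : MLQ lam n, ∀ c, label (numRows lam) n A.balls 1 c ≠ 0 →
      c ∈ rowSet (rho (numRows lam) n A.balls) 1 := by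
    intro A c hc
    obtain ⟨as, h⟩ := exists_hasExponents (k := 0) hL hL A.subset_grid (hf 0 hL A)
    have h1 : c ∈ geSet n (label (numRows lam) n A.balls 1) (0 + 1) :=
      mem_geSet.2 ⟨bounds_of_mem_rowSet A.subset_grid 1 c (((hlab A).ne_zero_iff c).1 hc), by omega⟩
    rw [h.geSet_label hL A.subset_grid (hcard A) (hf 0 hL A)] at h1
    have h2 := mem_geSet.1 (trim_subset _ _ _ h1)
    exact ((hlabρ A).ne_zero_iff c).1 (by omega)
  rw [strtype, type, strtype, type, filter_map_range'_eq (hbd M) hm _ (hsub M),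
    filter_map_range'_eq (hbd M') hm' _ (hsub M')]
  congr 1
  apply List.map_congr_left
  intro i _
  have b1 := hbound M ((rowSet (rho (numRows lam) n M.balls) 1).orderEmbOfFin hm i)
  have b2 := hbound M' ((rowSet (rho (numRows lam) n M'.balls) 1).orderEmbOfFin hm' i)
  have hlei := fun k => hle k i
  generalize label (numRows lam) n M.balls 1 _ = x at b1 hlei ⊢
  generalize label (numRows lam) n M'.balls 1 _ = y at b2 hlei ⊢
  -- The thresholds up to L separate two distinct labels, as both are at most L.
  rcases lt_trichotomy x y with h | h | h
  · have := (hlei (y - 1) (by omega)).2 (by omega)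
    omega
  · exact h
  · have := (hlei (x - 1) (by omega)).1 (by omega)
    omega
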